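/- Let $A$ be a finite alphabet with $|A|\ge 3$, let $A^*$ be the set of finite words over $A$, and write $u\preccurlyeq v$ if the word $u$ is a (not necessarily contiguous) subword of $v$, i.e. $u$ is obtained from $v$ by deleting letters at an arbitrary set of positions. Consider first-order logic with equality over the structure $(A^*,\preccurlyeq,(w)_{w\in A^*})$, which has the binary relation $\preccurlyeq$ and a constant symbol for every word $w\in A^*$. A $\Sigma_1$-formula is a formula of the form $\exists y_1\cdots\exists y_n\,\theta$ with $n\ge 0$ and $\theta$ quantifier-free. Then for every $k\ge 0$ and every relation $R\subseteq (A^*)^k$, the following are equivalent: 1. $R$ is definable by a $\Sigma_1$-formula, i.e. there is a $\Sigma_1$-formula $\varphi$ with free variables among $x_1,\dots,x_k$ such that $R$ is exactly the set of all $(v_1,\dots,v_k)\in (A^*)^k$ that satisfy $\varphi$; 2. $R$ is recursively enumerable. -/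

import Mathlib

open FirstOrder

/-- The structure `(A*, ≼)`: words over `A` are lists, and the binary symbol of the language of
orders is interpreted as the (non-contiguous) subword relation, which is `List.Sublist`.
(It is not the lexicographic order that `≤` denotes on lists.) -/
instance subwordStructure (A : Type*) : Language.order.Structure (List A) where
  funMap := fun f => Empty.elim f
  RelMap := fun {n} r => match n, r with
    | 2, .le => fun v => (v 0).Sublist (v 1)

/-- The language of `(A*, ≼)` with a constant symbol for every word. Its interpretation in
`List A`, where each constant symbol `w` denotes `w`, is found by instance search. -/
abbrev subwordLanguage (A : Type*) : Language :=
  Language.order[[List A]]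

/-- Definability of a relation `R ⊆ (A*)ᵏ` in the `Σ₁`-fragment over `(A*, ≼)` with all words as
constants: `IsExistential` holds for the formulas `∃ y₁ ⋯ ∃ yₙ, θ` with `n ≥ 0` and `θ`
quantifier-free. -/
def SigmaOneDefinable {A : Type*} {k : ℕ} (R : Set (Fin k → List A)) : Prop :=
  ∃ φ : (subwordLanguage A).Formula (Fin k),
    Language.BoundedFormula.IsExistential φ ∧ ∀ v : Fin k → List A, v ∈ R ↔ φ.Realize v

/-! That definable relations are recursively enumerable is routine: for fixed constants a
quantifier-free formula is a primitive recursive condition, because `≼` is decided by greedy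
matching, and existential quantifiers preserve recursive enumerability.

For the converse, definable predicates are closed under `∧`, `∨`, `∃` and, as the alphabet is
finite, conjunctions over letters; negation is available only at atoms. Two words `u ≼ v` with the
same number of each letter are equal, so equalities can be certified by counting. Counting needs the
successor on powers of a letter, which `replicate_succ_iff` obtains by a squeeze. It yields
projections to subalphabets and, with a spare letter as marker, concatenation (`append_iff`). The
equation `pu = up` then expresses that `u` is a power of the primitive word `p`
(`exists_eq_concat_of_commute`).

A sequence of numbers is coded as `a^(f 0) b a^(f 1) b ⋯`, and a third letter `c` is kept for
auxiliary work; here three letters are used. Pointwise addition rests on `c^i a^j ≼ (ac)^k ↔ i + j ≤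
k` and a comparison of totals (`enc_add_iff`). Relations on numbers are lifted pointwise to
sequences, so that one formula treats all positions at once. Running a step relation amounts to
shifting the sequence of states, which is an equation between concatenations (`runs_iff`). As the
runs for all positions proceed in parallel, the functions with definable lift are closed under
primitive recursion (`FunDefinable.prec`), hence include all primitive recursive ones.

Finally, a word is determined by its projections to pairs of letters (`eq_of_filter_onPair`), and
each projection has a numerical code whose computation is definable (`eq_num_code_iff`). A
recursively enumerable relation is the projection of a primitive recursive condition on these codes,
and that condition is definable. -/

namespace Subword

open Language

universe u

variable {A : Type u} {α β : Type}

/-- A predicate on assignments `α → A*` given by an existential formula: finitely many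
quantified words in front of a quantifier-free formula. -/
def Definable (P : (α → List A) → Prop) : Prop :=
  ∃ (β : Type) (_ : Finite β) (θ : (subwordLanguage A).Formula (α ⊕ β)),
    BoundedFormula.IsQF θ ∧ ∀ v, P v ↔ ∃ w : β → List A, θ.Realize (Sum.elim v w)

theorem isQF_relabel {θ : (subwordLanguage A).Formula α} (h : BoundedFormula.IsQF θ)
    (f : α → β) : BoundedFormula.IsQF (θ.relabel f : (subwordLanguage A).Formula β) :=
  BoundedFormula.IsQF.relabel h _

/-! ### Closure properties and atomic cases of `Σ₁`-definability. -/

namespace Definable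

theorem congr {P Q : (α → List A) → Prop} (h : Definable P) (H : ∀ v, Q v ↔ P v) :
    Definable Q := by
  obtain ⟨β, hβ, θ, hq, hθ⟩ := h
  exact ⟨β, hβ, θ, hq, fun v => (H v).trans (hθ v)⟩

theorem of_isQF {P : (α → List A) → Prop} (θ : (subwordLanguage A).Formula α)
    (hq : BoundedFormula.IsQF θ) (h : ∀ v, P v ↔ θ.Realize v) : Definable P :=
  ⟨Empty, inferInstance, θ.relabel Sum.inl, isQF_relabel hq _, fun v => by
    simp [h, Formula.realize_relabel]⟩

theorem const (p : Prop) : Definable (A := A) (α := α) fun _ => p := by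
  by_cases hp : p
  · exact of_isQF ⊤ BoundedFormula.IsQF.top fun v => by simp [hp]
  · exact of_isQF ⊥ BoundedFormula.isQF_bot fun v => by simp [hp]

theorem exs [Finite β] {P : (α → List A) → (β → List A) → Prop}
    (h : Definable (α := α ⊕ β) fun v => P (fun i => v (.inl i)) (fun i => v (.inr i))) :
    Definable fun v => ∃ w, P v w := by
  obtain ⟨γ, hγ, θ, hq, hθ⟩ := h
  refine ⟨β ⊕ γ, inferInstance, θ.relabel (Equiv.sumAssoc α β γ), isQF_relabel hq _, fun v => ?_⟩
  have key : ∀ w : β → List A, P v w ↔ ∃ z : γ → List A,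
      θ.Realize (Sum.elim (Sum.elim v w) z) := fun w => by
    simpa using hθ (Sum.elim v w)
  simp only [key, Formula.realize_relabel]
  constructor
  · rintro ⟨w, z, h⟩
    refine ⟨Sum.elim w z, ?_⟩
    convert h using 1
    ext ((_ | _) | _) <;> simp
  · rintro ⟨w, h⟩
    refine ⟨w ∘ .inl, w ∘ .inr, ?_⟩
    convert h using 1
    ext ((_ | _) | _) <;> simp

theorem subst {P : (α → List A) → Prop} (h : Definable P) (f : α → β) :
    Definable fun v : β → List A => P (fun i => v (f i)) := by
  obtain ⟨γ, hγ, θ, hq, hθ⟩ := h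
  refine ⟨γ, hγ, θ.relabel (Sum.map f id), isQF_relabel hq _, fun v => ?_⟩
  refine (hθ _).trans ?_
  simp only [Formula.realize_relabel, Sum.elim_comp_map]
  rfl

theorem ex {P : (α → List A) → List A → Prop}
    (h : Definable fun v : Option α → List A => P (fun i => v (some i)) (v none)) :
    Definable fun v => ∃ x, P v x := by
  have := h.subst (β := α ⊕ Unit) (fun o => o.elim (.inr ()) .inl)
  refine (exs (P := fun v (w : Unit → List A) => P v (w ())) this).congr fun v => ?_
  exact ⟨fun ⟨x, h⟩ => ⟨fun _ => x, h⟩, fun ⟨w, h⟩ => ⟨w (), h⟩⟩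

theorem and {P Q : (α → List A) → Prop} (hP : Definable P) (hQ : Definable Q) :
    Definable fun v => P v ∧ Q v := by
  obtain ⟨β, hβ, θ, hq, hθ⟩ := hP
  obtain ⟨γ, hγ, η, hr, hη⟩ := hQ
  refine ⟨β ⊕ γ, inferInstance, θ.relabel (Sum.map id .inl) ⊓ η.relabel (Sum.map id .inr),
    (isQF_relabel hq _).inf (isQF_relabel hr _), fun v => ?_⟩
  simp only [hθ, hη, Formula.realize_inf, Formula.realize_relabel, Sum.elim_comp_map,
    Function.comp_id]
  constructor
  · rintro ⟨⟨w, h⟩, z, h'⟩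
    exact ⟨Sum.elim w z, by simpa using h, by simpa using h'⟩
  · rintro ⟨w, h, h'⟩
    exact ⟨⟨_, h⟩, _, h'⟩

theorem or {P Q : (α → List A) → Prop} (hP : Definable P) (hQ : Definable Q) :
    Definable fun v => P v ∨ Q v := by
  obtain ⟨β, hβ, θ, hq, hθ⟩ := hP
  obtain ⟨γ, hγ, η, hr, hη⟩ := hQ
  refine ⟨β ⊕ γ, inferInstance, θ.relabel (Sum.map id .inl) ⊔ η.relabel (Sum.map id .inr),
    (isQF_relabel hq _).sup (isQF_relabel hr _), fun v => ?_⟩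
  simp only [hθ, hη, Formula.realize_sup, Formula.realize_relabel, Sum.elim_comp_map,
    Function.comp_id]
  constructor
  · rintro (⟨w, h⟩ | ⟨z, h'⟩)
    -- The witnesses of the other disjunct are irrelevant; the empty word serves as a default.
    · exact ⟨Sum.elim w fun _ => [], .inl (by simpa using h)⟩
    · exact ⟨Sum.elim (fun _ => []) z, .inr (by simpa using h')⟩
  · rintro ⟨w, h | h⟩
    · exact .inl ⟨_, h⟩
    · exact .inr ⟨_, h⟩

/-- Used mostly with `ι` the alphabet: a quantifier over letters is a finite conjunction and costs
no universal quantifier over words. -/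
theorem all {ι : Type*} [Finite ι] {P : ι → (α → List A) → Prop} (h : ∀ i, Definable (P i)) :
    Definable fun v => ∀ i, P i v := by
  cases nonempty_fintype ι
  have : ∀ s : Finset ι, Definable fun v => ∀ i ∈ s, P i v := by
    intro s
    classical
    induction s using Finset.induction_on with
    | empty => exact (const True).congr fun v => by simp
    | insert i s hi ih => exact ((h i).and ih).congr fun v => by simp
  exact (this Finset.univ).congr fun v => by simp

theorem eq (i j : α) : Definable fun v : α → List A => v i = v j :=
  of_isQF ((var i : (subwordLanguage A).Term α).equal (var j))
    (BoundedFormula.IsAtomic.equal _ _).isQF fun v => by simp [Formula.realize_equal]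

theorem coe_word (w : List A) : ((Language.order.con w : (subwordLanguage A).Constants) : List A) = w :=
  rfl

/-- The atomic formula `s ≼ t`. -/
def leFormula (s t : (subwordLanguage A).Term α) : (subwordLanguage A).Formula α :=
  Relations.formula₂ (Sum.inl Language.leSymb : (subwordLanguage A).Relations 2) s t

theorem realize_leFormula (s t : (subwordLanguage A).Term α) (v : α → List A) :
    (leFormula s t).Realize v ↔ (s.realize v).Sublist (t.realize v) :=
  Formula.realize_rel₂.trans Iff.rfl

theorem isQF_leFormula (s t : (subwordLanguage A).Term α) :
    BoundedFormula.IsQF (leFormula s t) :=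
  (BoundedFormula.IsAtomic.rel _ _).isQF

theorem eq_const (i : α) (w : List A) : Definable fun v : α → List A => v i = w :=
  of_isQF ((var i : (subwordLanguage A).Term α).equal (Constants.term (Language.order.con w)))
    (BoundedFormula.IsAtomic.equal _ _).isQF fun v => by
      simp [Formula.realize_equal, coe_word]

theorem sub (i j : α) : Definable fun v : α → List A => (v i).Sublist (v j) :=
  of_isQF (leFormula (var i) (var j)) (isQF_leFormula _ _) fun v => by simp [realize_leFormula]

theorem not_sub (i j : α) : Definable fun v : α → List A => ¬ (v i).Sublist (v j) :=
  of_isQF (leFormula (var i) (var j)).not (isQF_leFormula _ _).not fun v => by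
    simp [realize_leFormula, Formula.realize_not]

theorem const_sub (w : List A) (i : α) : Definable fun v : α → List A => w.Sublist (v i) :=
  of_isQF (leFormula (Constants.term (Language.order.con w)) (var i)) (isQF_leFormula _ _) fun v => by
    simp [realize_leFormula, coe_word]

theorem not_const_sub (w : List A) (i : α) : Definable fun v : α → List A => ¬ w.Sublist (v i) :=
  of_isQF (leFormula (Constants.term (Language.order.con w)) (var i)).not (isQF_leFormula _ _).not
    fun v => by simp [realize_leFormula, Formula.realize_not, coe_word]

theorem isExistential_exs {n : ℕ} {φ : (subwordLanguage A).BoundedFormula α n}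
    (h : φ.IsExistential) : BoundedFormula.IsExistential φ.exs := by
  induction n with
  | zero => exact h
  | succ n ih => exact ih (.ex h)

theorem sigmaOneDefinable {k : ℕ} {R : Set (Fin k → List A)}
    (h : Definable fun v => v ∈ R) : SigmaOneDefinable R := by
  obtain ⟨β, hβ, θ, hq, hθ⟩ := h
  refine ⟨θ.iExs β, ?_, fun v => ?_⟩
  · unfold Formula.iExs
    exact isExistential_exs (hq.relabel _).isExistential
  · exact (hθ v).trans Formula.realize_iExs.symm

end Definable

end Subword

namespace Subword

universe u

open List

/-! ### Counting, projection and concatenation expressed by subwords. -/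

section Words

variable {A : Type u} [DecidableEq A]

/-- Embeddings respect the first occurrence of a letter that occurs equally often afterwards. -/
theorem sublist_split {z : A} {s t q r : List A} (hs : z ∉ s) (hq : z ∉ q)
    (hc : r.count z ≤ t.count z) (h : s ++ z :: t <+ q ++ z :: r) : s <+ q ∧ t <+ r := by
  obtain ⟨l₁, l₂, he, h₁, h₂⟩ := sublist_append_iff.1 h
  have hl₁ : z ∉ l₁ := fun hz => hq (h₁.subset hz)
  rcases append_eq_append_iff.1 he with ⟨m, hm, hm'⟩ | ⟨m, hm, hm'⟩
  · rcases m with _ | ⟨x, m⟩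
    · simp only [append_nil] at hm
      simp only [nil_append] at hm'
      rw [← hm'] at h₂
      exact ⟨hm ▸ h₁, by simpa using h₂⟩
    · simp only [cons_append, cons.injEq] at hm'
      exact absurd (by simp [hm, hm'.1]) hl₁
  · rw [hm'] at h₂
    rcases m with _ | ⟨x, m⟩
    · simp only [append_nil] at hm
      exact ⟨hm ▸ h₁, by simpa using h₂⟩
    -- If a nonempty end of `s` spilled over past `q`, then the displayed `z` and all of `t` would
    -- embed into `r`, which has too few letters `z`.
    · have hx : x ≠ z := fun hx => hs (by simp [hm, hx])
      rw [cons_append] at h₂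
      have h₃ := (h₂.of_cons_of_ne hx).count_le z
      simp only [count_cons_of_ne hx, count_append, count_cons_self] at h₃
      omega

theorem count_append_cons {z : A} {s t : List A} (hs : z ∉ s) (ht : z ∉ t) :
    (s ++ z :: t).count z = 1 := by
  simp [count_append, count_eq_zero_of_not_mem hs, count_eq_zero_of_not_mem ht]

theorem exists_split_of_count_eq_one {z : A} {l : List A} (h : l.count z = 1) :
    ∃ s t, l = s ++ z :: t ∧ z ∉ s ∧ z ∉ t := by
  have hz : z ∈ l := count_pos_iff.1 (by omega)
  obtain ⟨s, t, rfl, hs⟩ := eq_append_cons_of_mem hz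
  refine ⟨s, t, rfl, hs, fun ht => ?_⟩
  have := count_pos_iff.2 ht
  simp [count_append] at h
  omega

theorem replicate_sublist_split {a b : A} (hab : a ≠ b) {l i j : ℕ} {r : ℕ} :
    replicate l a ++ b :: replicate r a <+ replicate i a ++ b :: replicate j a ↔
      l ≤ i ∧ r ≤ j := by
  constructor
  · intro h
    obtain ⟨h₁, h₂⟩ := sublist_split (by simp [hab.symm]) (by simp [hab.symm])
      (by simp [count_replicate, hab]) h
    exact ⟨by simpa using h₁.length_le, by simpa using h₂.length_le⟩
  · rintro ⟨h₁, h₂⟩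
    exact (replicate_sublist_replicate a |>.2 h₁).append
      ((replicate_sublist_replicate a |>.2 h₂).cons_cons b)

theorem replicate_sublist_mid {a b : A} (hab : a ≠ b) {m i j : ℕ} :
    replicate m a <+ replicate i a ++ b :: replicate j a ↔ m ≤ i + j := by
  rw [replicate_sublist_iff]
  simp [count_append, hab.symm]

/-- The words `a⋯a b aʳ`, as a piecewise testable language. -/
theorem eq_replicate_append_iff {a b : A} (hab : a ≠ b) (r : ℕ) (v : List A) :
    (∃ i, v = replicate i a ++ b :: replicate r a) ↔
      (∀ y, (y = a ∨ y = b) ∨ ¬ [y] <+ v) ∧ ¬ [b, b] <+ v ∧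
        (b :: replicate r a) <+ v ∧ ¬ (b :: replicate (r + 1) a) <+ v := by
  constructor
  · rintro ⟨i, rfl⟩
    refine ⟨fun y => ?_, fun h => ?_, ?_, fun h => ?_⟩
    · rw [singleton_sublist, mem_append, mem_cons, mem_replicate, mem_replicate]
      tauto
    · have := h.count_le b
      simp [count_append, count_replicate, hab] at this
    · simp
    · have := (replicate_sublist_split hab (l := 0)).1 h
      omega
  · rintro ⟨h₁, h₂, h₃, h₄⟩
    have hb : v.count b = 1 := by
      have : 1 ≤ v.count b := count_pos_iff.2 (h₃.subset (by simp))
      have : ¬ 2 ≤ v.count b := fun h => h₂ (replicate_sublist_iff (n := 2).2 h)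
      omega
    obtain ⟨s, t, rfl, hs, ht⟩ := exists_split_of_count_eq_one hb
    have hrep : ∀ l : List A, (∀ y ∈ l, y ∈ s ++ b :: t) → b ∉ l →
        l = replicate l.length a := fun l hl hbl => by
      refine eq_replicate_of_mem fun y hy => ?_
      rcases h₁ y with (h | h) | h
      · exact h
      · exact absurd (h ▸ hy) hbl
      · exact absurd (singleton_sublist.2 (hl y hy)) h
    obtain ⟨i, rfl⟩ : ∃ i, s = replicate i a := ⟨_, hrep s (by simp +contextual) hs⟩
    obtain ⟨j, rfl⟩ : ∃ j, t = replicate j a := ⟨_, hrep t (by simp +contextual) ht⟩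
    have h₃' := (replicate_sublist_split hab (l := 0)).1 h₃
    have h₄' := mt (replicate_sublist_split hab (l := 0)).2 h₄
    have : j = r := by omega
    exact ⟨i, by rw [this]⟩

/-- A squeeze. For `p = a^k`, `q = a^m`, `z = a^i b a³` and `v = a^l b`, the last three conditions
say `m ≤ i + 3`, `l < k` and `i < l`. Hence `m ≤ k + 1`, while `p` being a proper subword of `q`
gives `k < m`. Such `i` and `l` exist only for `k ≥ 2`, so two pairs are listed separately. -/
theorem replicate_succ_iff {a b : A} (hab : a ≠ b) (p q : List A) :
    (∃ n, p = replicate n a ∧ q = replicate (n + 1) a) ↔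
      (p = [] ∧ q = [a] ∨ p = [a] ∧ q = [a, a]) ∨
      (∀ y, y = a ∨ ¬ [y] <+ p) ∧ (∀ y, y = a ∨ ¬ [y] <+ q) ∧ p <+ q ∧ ¬ q <+ p ∧
        ∃ z, (∃ i, z = replicate i a ++ b :: replicate 3 a) ∧ ∃ v,
          (∃ i, v = replicate i a ++ b :: replicate 0 a) ∧ q <+ z ∧ ¬ p <+ v ∧ ¬ v <+ z := by
  constructor
  · rintro ⟨n, rfl, rfl⟩
    rcases n with _ | _ | n
    · simp
    · simp [replicate]
    · right
      refine ⟨fun y => ?_, fun y => ?_, ?_, ?_, _, ⟨n, rfl⟩, _, ⟨n + 1, rfl⟩, ?_, ?_, ?_⟩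
      · simp only [singleton_sublist, mem_replicate]; tauto
      · simp only [singleton_sublist, mem_replicate]; tauto
      · simp
      · simp
      · rw [replicate_sublist_mid hab]
      · rw [replicate_sublist_mid hab]; omega
      · rw [replicate_sublist_split hab]; omega
  · rintro ((⟨rfl, rfl⟩ | ⟨rfl, rfl⟩) | ⟨hp, hq, hpq, hqp, z, ⟨i, rfl⟩, v, ⟨l, rfl⟩, h₁, h₂, h₃⟩)
    · exact ⟨0, rfl, rfl⟩
    · exact ⟨1, rfl, rfl⟩
    · have hrep : ∀ p : List A, (∀ y, y = a ∨ ¬ [y] <+ p) → p = replicate p.length a :=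
        fun p hp => eq_replicate_of_mem fun y hy =>
          (hp y).resolve_right (not_not.2 (singleton_sublist.2 hy))
      rw [hrep p hp, hrep q hq] at *
      generalize p.length = k at *
      generalize q.length = m at *
      rw [replicate_sublist_mid hab] at h₁ h₂
      rw [replicate_sublist_split hab] at h₃
      rw [replicate_sublist_replicate] at hpq hqp
      have : m = k + 1 := by omega
      exact ⟨k, rfl, by rw [this]⟩

/-- The longest power of `a` inside `u` is the one whose successor no longer embeds. -/
theorem eq_replicate_count_iff (a : A) (u p : List A) :
    p = replicate (u.count a) a ↔
      p <+ u ∧ ∃ q, (∃ n, p = replicate n a ∧ q = replicate (n + 1) a) ∧ ¬ q <+ u := by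
  constructor
  · rintro rfl
    refine ⟨replicate_sublist_iff.2 le_rfl, _, ⟨_, rfl, rfl⟩, ?_⟩
    rw [replicate_sublist_iff]; omega
  · rintro ⟨h, q, ⟨n, rfl, rfl⟩, hq⟩
    rw [replicate_sublist_iff] at h hq
    congr 1; omega

theorem eq_filter_iff (p : A → Bool) (u v : List A) :
    u = v.filter p ↔ u <+ v ∧ ∀ y, if p y then u.count y = v.count y else ¬ [y] <+ u := by
  constructor
  · rintro rfl
    refine ⟨filter_sublist, fun y => ?_⟩
    split_ifs with h
    · rw [count_filter h]
    · simp [h]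
  · rintro ⟨h, hc⟩
    have h₁ : u <+ v.filter p := by
      have := h.filter p
      rwa [filter_eq_self.2] at this
      intro y hy
      by_contra hp
      have := hc y
      simp [hp] at this
      exact this hy
    refine h₁.eq_of_length (Perm.length_eq (perm_iff_count.2 fun y => ?_))
    have := hc y
    split_ifs at this with hp
    · rw [this, count_filter hp]
    · rw [count_eq_zero_of_not_mem (by simpa using this), count_eq_zero_of_not_mem (by simp [hp])]

theorem filter_ne_eq_self {c : A} {s : List A} (h : c ∉ s) : s.filter (· ≠ c) = s :=
  filter_eq_self.2 fun y hy => by simpa using fun hc : y = c => h (hc ▸ hy)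

/-- If nothing follows the first `c` in `s`, then `c` is the last letter and occurs once, so
deleting it recovers `u`. -/
theorem snoc_iff (c : A) (u s : List A) :
    (c ∉ u ∧ s = u ++ [c]) ↔ [c] <+ s ∧ (∀ y, ¬ [c, y] <+ s) ∧ u = s.filter (· ≠ c) := by
  constructor
  · rintro ⟨hc, rfl⟩
    refine ⟨by simp, fun y h => ?_, ?_⟩
    · have := (sublist_split (s := []) (t := [y]) (by simp) hc (by simp) h).2
      simp at this
    · rw [filter_append, filter_ne_eq_self hc]
      simp
  · rintro ⟨h₁, h₂, rfl⟩
    refine ⟨by simp, ?_⟩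
    obtain ⟨s, t, rfl, hs⟩ := eq_append_cons_of_mem (singleton_sublist.1 h₁)
    rcases t with _ | ⟨y, t⟩
    · rw [filter_append, filter_ne_eq_self hs]
      simp
    · exact absurd (by simp : [c, y] <+ s ++ c :: y :: t) (h₂ y)

theorem cons_iff (c : A) (u s : List A) :
    (c ∉ u ∧ s = c :: u) ↔ [c] <+ s ∧ (∀ y, ¬ [y, c] <+ s) ∧ u = s.filter (· ≠ c) := by
  have := snoc_iff c u.reverse s.reverse
  rw [mem_reverse, ← reverse_cons, reverse_inj] at this
  rw [this, filter_reverse, reverse_inj, ← reverse_sublist (l₁ := [c])]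
  simp only [reverse_cons, reverse_nil, nil_append, reverse_reverse]
  refine and_congr_right fun _ => and_congr_left fun _ => forall_congr' fun y => ?_
  rw [← reverse_sublist (l₁ := [y, c])]
  simp

/-- The single `c` acts as a marker: `uc ≼ sct` forces `u ≼ s`, and the failure of `x^(n+1) c ≼ sct`
with `n` the count of `x` in `u` says that `s` has no more letters `x` than `u`. A subword with the
same letter counts is the whole word. -/
theorem eq_left_iff (c : A) (u s t : List A) (hs : c ∉ s) (ht : c ∉ t) :
    u = s ↔ ∃ e, (c ∉ u ∧ e = u ++ [c]) ∧ e <+ s ++ c :: t ∧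
      ∀ x, x = c ∨ ∃ p, p = replicate (u.count x) x ∧
        ∃ q, (∃ n, p = replicate n x ∧ q = replicate (n + 1) x) ∧
        ∃ f, (c ∉ q ∧ f = q ++ [c]) ∧ ¬ f <+ s ++ c :: t := by
  constructor
  · rintro rfl
    refine ⟨_, ⟨hs, rfl⟩, by simp, fun x => or_iff_not_imp_left.2 fun hx => ?_⟩
    refine ⟨_, rfl, _, ⟨_, rfl, rfl⟩, _, ⟨?_, rfl⟩, fun h => ?_⟩
    · simp [Ne.symm hx]
    · have := (sublist_split (t := []) (by simp [Ne.symm hx]) hs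
        (by simp [count_eq_zero_of_not_mem ht]) h).1
      rw [replicate_sublist_iff] at this
      omega
  · rintro ⟨e, ⟨hu, rfl⟩, h, hx⟩
    have h₁ := (sublist_split (t := []) hu hs (by simp [count_eq_zero_of_not_mem ht]) h).1
    refine h₁.eq_of_length (Perm.length_eq (perm_iff_count.2 fun y => ?_))
    rcases hx y with rfl | ⟨p, rfl, q, ⟨n, hn, rfl⟩, f, ⟨hq, rfl⟩, hf⟩
    · rw [count_eq_zero_of_not_mem hu, count_eq_zero_of_not_mem hs]
    · have hn' : u.count y = n := by simpa using congrArg length hn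
      refine le_antisymm (h₁.count_le y) (not_lt.1 fun hlt => hf ?_)
      refine Sublist.append (replicate_sublist_iff.2 ?_) (by simp)
      omega

theorem eq_right_iff (c : A) (u s t : List A) (hs : c ∉ s) (ht : c ∉ t) :
    u = t ↔ ∃ e, (c ∉ u ∧ e = c :: u) ∧ e <+ s ++ c :: t ∧
      ∀ x, x = c ∨ ∃ p, p = replicate (u.count x) x ∧
        ∃ q, (∃ n, p = replicate n x ∧ q = replicate (n + 1) x) ∧
        ∃ f, (c ∉ q ∧ f = c :: q) ∧ ¬ f <+ s ++ c :: t := by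
  constructor
  · rintro rfl
    refine ⟨_, ⟨ht, rfl⟩, by simp, fun x => or_iff_not_imp_left.2 fun hx => ?_⟩
    refine ⟨_, rfl, _, ⟨_, rfl, rfl⟩, _, ⟨?_, rfl⟩, fun h => ?_⟩
    · simp [Ne.symm hx]
    · have := (sublist_split (s := []) (by simp) hs
        (by simp [count_eq_zero_of_not_mem ht]) h).2
      rw [replicate_sublist_iff] at this
      omega
  · rintro ⟨e, ⟨hu, rfl⟩, h, hx⟩
    have h₁ := (sublist_split (s := []) (by simp) hs (by simp [count_eq_zero_of_not_mem ht]) h).2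
    refine h₁.eq_of_length (Perm.length_eq (perm_iff_count.2 fun y => ?_))
    rcases hx y with rfl | ⟨p, rfl, q, ⟨n, hn, rfl⟩, f, ⟨hq, rfl⟩, hf⟩
    · rw [count_eq_zero_of_not_mem hu, count_eq_zero_of_not_mem ht]
    · have hn' : u.count y = n := by simpa using congrArg length hn
      refine le_antisymm (h₁.count_le y) (not_lt.1 fun hlt => hf ?_)
      refine Sublist.trans ?_ (sublist_append_right s _)
      refine Sublist.cons_cons _ (replicate_sublist_iff.2 ?_)
      omega

theorem count_eq_iff (a : A) (u v : List A) :
    u.count a = v.count a ↔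
      ∃ p, p = replicate (u.count a) a ∧ p = replicate (v.count a) a := by
  constructor
  · exact fun h => ⟨_, rfl, by rw [h]⟩
  · rintro ⟨p, h, h'⟩
    simpa using congrArg length (h.symm.trans h')

/-- The witness is `z = u₁ c u₂`: both factors can be read off around the marker, and deleting the
marker gives the product. -/
theorem append_iff (c : A) (u₁ u₂ w : List A) :
    (c ∉ u₁ ∧ c ∉ u₂ ∧ w = u₁ ++ u₂) ↔ ∃ z, [c] <+ z ∧ ¬ [c, c] <+ z ∧
      (∃ e, (c ∉ u₁ ∧ e = u₁ ++ [c]) ∧ e <+ z ∧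
        ∀ x, x = c ∨ ∃ p, p = replicate (u₁.count x) x ∧
          ∃ q, (∃ n, p = replicate n x ∧ q = replicate (n + 1) x) ∧
          ∃ f, (c ∉ q ∧ f = q ++ [c]) ∧ ¬ f <+ z) ∧
      (∃ e, (c ∉ u₂ ∧ e = c :: u₂) ∧ e <+ z ∧
        ∀ x, x = c ∨ ∃ p, p = replicate (u₂.count x) x ∧
          ∃ q, (∃ n, p = replicate n x ∧ q = replicate (n + 1) x) ∧
          ∃ f, (c ∉ q ∧ f = c :: q) ∧ ¬ f <+ z) ∧
      w = z.filter (· ≠ c) := by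
  constructor
  · rintro ⟨hi, hj, hk⟩
    refine ⟨u₁ ++ c :: u₂, by simp, fun h => ?_, (eq_left_iff c _ _ _ hi hj).1 rfl,
      (eq_right_iff c _ _ _ hi hj).1 rfl, ?_⟩
    · have := h.count_le c
      rw [count_append_cons hi hj] at this
      simp at this
    · rw [hk, filter_append, filter_cons_of_neg (by simp), filter_ne_eq_self hi, filter_ne_eq_self hj]
  · rintro ⟨z, h₁, h₂, h₃, h₄, h₅⟩
    have hz : z.count c = 1 := by
      have : 1 ≤ z.count c := count_pos_iff.2 (singleton_sublist.1 h₁)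
      have : ¬ 2 ≤ z.count c := fun h => h₂ (replicate_sublist_iff (n := 2).2 h)
      omega
    obtain ⟨s, t, rfl, hs, ht⟩ := exists_split_of_count_eq_one hz
    have hi := (eq_left_iff c _ _ _ hs ht).2 h₃
    have hj := (eq_right_iff c _ _ _ hs ht).2 h₄
    refine ⟨hi ▸ hs, hj ▸ ht, ?_⟩
    rw [h₅, filter_append, filter_cons_of_neg (by simp), filter_ne_eq_self hs, filter_ne_eq_self ht,
      hi, hj]

end Words

/-! ### Definability of counting, projection and concatenation. -/

namespace Definable

variable {A : Type u} [DecidableEq A] [Finite A] {α : Type}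

theorem replicateAppend {a b : A} (hab : a ≠ b) (r : ℕ) (i : α) :
    Definable fun v : α → List A => ∃ n, v i = replicate n a ++ b :: replicate r a :=
  ((all fun _ => (const _).or (not_const_sub _ _)).and <|
    (not_const_sub _ _).and <| (const_sub _ _).and (not_const_sub _ _)).congr fun _ =>
      eq_replicate_append_iff hab r _

theorem replicateSucc [Nontrivial A] (a : A) (i j : α) :
    Definable fun v : α → List A => ∃ n, v i = replicate n a ∧ v j = replicate (n + 1) a := by
  obtain ⟨b, hb⟩ := exists_ne a
  exact ((((eq_const _ _).and (eq_const _ _)).or ((eq_const _ _).and (eq_const _ _))).or <|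
    (all fun _ => (const _).or (not_const_sub _ _)).and <|
    (all fun _ => (const _).or (not_const_sub _ _)).and <|
    (sub _ _).and <| (not_sub _ _).and <| ex <| (replicateAppend hb.symm _ _).and <| ex <|
    (replicateAppend hb.symm _ _).and <| (sub _ _).and <| (not_sub _ _).and (not_sub _ _)).congr
      fun _ => replicate_succ_iff hb.symm _ _

variable [Nontrivial A]

theorem replicateCount (a : A) (i j : α) :
    Definable fun v : α → List A => v j = replicate ((v i).count a) a :=
  ((sub _ _).and <| ex <| (replicateSucc _ _ _).and (not_sub _ _)).congr fun _ =>
    eq_replicate_count_iff a _ _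

theorem countEq (a : A) (i j : α) :
    Definable fun v : α → List A => (v i).count a = (v j).count a :=
  (ex <| (replicateCount _ _ _).and (replicateCount _ _ _)).congr fun _ => count_eq_iff a _ _

theorem filter (p : A → Bool) (i j : α) :
    Definable fun v : α → List A => v j = (v i).filter p := by
  refine ((sub _ _).and <| all fun y => ?_).congr fun _ => eq_filter_iff p _ _
  split_ifs
  · exact countEq _ _ _
  · exact not_const_sub _ _

theorem snoc (c : A) (i j : α) :
    Definable fun v : α → List A => c ∉ v i ∧ v j = v i ++ [c] :=
  ((const_sub _ _).and <| (all fun _ => not_const_sub _ _).and (filter _ _ _)).congr fun _ =>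
    snoc_iff c _ _

theorem cons (c : A) (i j : α) :
    Definable fun v : α → List A => c ∉ v i ∧ v j = c :: v i :=
  ((const_sub _ _).and <| (all fun _ => not_const_sub _ _).and (filter _ _ _)).congr fun _ =>
    cons_iff c _ _

/-- Concatenation of words in which some letter `c` does not occur. -/
theorem append (c : A) (i j k : α) :
    Definable fun v : α → List A => c ∉ v i ∧ c ∉ v j ∧ v k = v i ++ v j :=
  (ex <| (const_sub _ _).and <| (not_const_sub _ _).and <|
    (ex <| (snoc _ _ _).and <| (sub _ _).and <| all fun _ => (const _).or <| ex <|
      (replicateCount _ _ _).and <| ex <| (replicateSucc _ _ _).and <| ex <|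
      (snoc _ _ _).and (not_sub _ _)).and <|
    (ex <| (cons _ _ _).and <| (sub _ _).and <| all fun _ => (const _).or <| ex <|
      (replicateCount _ _ _).and <| ex <| (replicateSucc _ _ _).and <| ex <|
      (cons _ _ _).and (not_sub _ _)).and (filter _ _ _)).congr
    fun _ => append_iff c _ _ _

end Definable

/-! ### Powers of primitive words, block codes, and words sorted between separators. -/

section Blocks

variable {A : Type u}

/-- The concatenation `f 0 ⋯ f (n - 1)`. -/
def concat (n : ℕ) (f : ℕ → List A) : List A :=
  (range n).flatMap f

@[simp]
theorem concat_zero (f : ℕ → List A) : concat 0 f = [] := rfl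

theorem concat_succ (n : ℕ) (f : ℕ → List A) : concat (n + 1) f = concat n f ++ f n := by
  simp [concat, range_succ]

theorem concat_succ' (n : ℕ) (f : ℕ → List A) :
    concat (n + 1) f = f 0 ++ concat n fun t => f (t + 1) := by
  simp [concat, range_succ_eq_map, flatMap_map]

theorem concat_add (m n : ℕ) (f : ℕ → List A) :
    concat (m + n) f = concat m f ++ concat n fun t => f (m + t) := by
  induction n with
  | zero => simp
  | succ n ih => rw [← add_assoc, concat_succ, ih, concat_succ, append_assoc]

theorem concat_congr {n : ℕ} {f g : ℕ → List A} (h : ∀ t < n, f t = g t) :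
    concat n f = concat n g := by
  induction n with
  | zero => rfl
  | succ n ih => rw [concat_succ, concat_succ, ih fun t ht => h t (by omega), h n (by omega)]

theorem filter_concat (p : A → Bool) (n : ℕ) (f : ℕ → List A) :
    (concat n f).filter p = concat n fun t => (f t).filter p := by
  simp [concat, filter_flatMap]

theorem flatMap_concat (σ : A → List A) (n : ℕ) (f : ℕ → List A) :
    (concat n f).flatMap σ = concat n fun t => (f t).flatMap σ := by
  simp [concat, flatMap_assoc]

theorem map_concat (σ : A → A) (n : ℕ) (f : ℕ → List A) :
    (concat n f).map σ = concat n fun t => (f t).map σ := by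
  simp [concat, map_flatMap]

theorem mem_concat {n : ℕ} {f : ℕ → List A} {y : A} :
    y ∈ concat n f ↔ ∃ t < n, y ∈ f t := by
  simp [concat]

theorem concat_sublist {n : ℕ} {f g : ℕ → List A} (h : ∀ t < n, f t <+ g t) :
    concat n f <+ concat n g := by
  induction n with
  | zero => simp
  | succ n ih =>
    rw [concat_succ, concat_succ]
    exact (ih fun t ht => h t (by omega)).append (h n (by omega))

/-- The hypothesis `hprim` is primitivity of `p`. If `x` is at least as long as `p`, then `p` can be
stripped from `x` and the rest still commutes with `p`; a shorter nonempty `x` would split `p` into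
two commuting factors. -/
theorem exists_eq_concat_of_commute {p : List A} (hp : p ≠ [])
    (hprim : ∀ x y, x ≠ [] → y ≠ [] → p = x ++ y → p ≠ y ++ x) (x : List A)
    (h : p ++ x = x ++ p) : ∃ n, x = concat n fun _ => p := by
  induction hx : x.length using Nat.strong_induction_on generalizing x with
  | _ k ih =>
    rcases eq_or_ne x [] with rfl | hne
    · exact ⟨0, rfl⟩
    rcases append_eq_append_iff.1 h with ⟨m, hm, hm'⟩ | ⟨m, hm, hm'⟩
    · subst hm
      obtain ⟨n, hn⟩ := ih m.length (by
        have := length_pos_iff.2 hp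
        simp at hx; omega) m hm' rfl
      exact ⟨n + 1, by rw [concat_succ', ← hn]⟩
    · rcases eq_or_ne m [] with rfl | hm0
      · refine ⟨1, ?_⟩
        simpa [concat_succ] using hm.symm
      · exact absurd hm' (hprim x m hne hm0 hm)

/-- The code `x^(f 0) z ⋯ x^(f (n - 1)) z` of a sequence of natural numbers. -/
def enc (x z : A) (n : ℕ) (f : ℕ → ℕ) : List A :=
  concat n fun t => replicate (f t) x ++ [z]

theorem enc_congr {x z : A} {n : ℕ} {f g : ℕ → ℕ} (h : ∀ t < n, f t = g t) :
    enc x z n f = enc x z n g :=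
  concat_congr fun t ht => by rw [h t ht]

theorem enc_add {x z : A} {m n : ℕ} (f : ℕ → ℕ) :
    enc x z (m + n) f = enc x z m f ++ enc x z n fun t => f (m + t) :=
  concat_add _ _ _

theorem mem_enc {x z : A} {n : ℕ} {f : ℕ → ℕ} {y : A} (h : y ∈ enc x z n f) : y = x ∨ y = z := by
  obtain ⟨t, -, h⟩ := mem_concat.1 h
  simp at h
  tauto

theorem exists_append_eq_enc {x z : A} {w : List A} (h : ∀ y ∈ w, y = x ∨ y = z) :
    ∃ n f, w ++ [z] = enc x z (n + 1) f := by
  induction w with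
  | nil => exact ⟨0, fun _ => 0, by simp [enc, concat_succ]⟩
  | cons y w ih =>
    obtain ⟨n, f, hf⟩ := ih fun y hy => h y (by simp [hy])
    rw [cons_append, hf]
    rcases h y (by simp) with rfl | rfl
    · refine ⟨n, fun t => if t = 0 then f 0 + 1 else f t, ?_⟩
      simp [enc, concat_succ', replicate_succ]
    · refine ⟨n + 1, fun t => if t = 0 then 0 else f (t - 1), ?_⟩
      simp [enc, concat_succ' (n + 1)]

theorem exists_eq_enc_iff {x z : A} (w : List A) :
    (∃ n f, w = enc x z n f) ↔ w = [] ∨ ∃ u, (∀ y ∈ u, y = x ∨ y = z) ∧ w = u ++ [z] := by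
  constructor
  · rintro ⟨n, f, rfl⟩
    rcases n with _ | n
    · simp [enc]
    · refine .inr ⟨enc x z n f ++ replicate (f n) x, fun y hy => ?_, ?_⟩
      · rcases mem_append.1 hy with hy | hy
        · exact mem_enc hy
        · simp at hy; tauto
      · simp [enc, concat_succ]
  · rintro (rfl | ⟨u, hu, rfl⟩)
    · exact ⟨0, fun _ => 0, rfl⟩
    · obtain ⟨n, f, h⟩ := exists_append_eq_enc hu
      exact ⟨_, f, h⟩

theorem not_sublist_replicate_append {x y : A} (hxy : x ≠ y) (N M : ℕ) :
    ¬ [y, x] <+ replicate N x ++ replicate M y := by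
  intro h
  obtain ⟨l₁, l₂, h, h₁, h₂⟩ := sublist_append_iff.1 h
  obtain ⟨i, -, rfl⟩ := sublist_replicate_iff.1 h₁
  obtain ⟨j, -, rfl⟩ := sublist_replicate_iff.1 h₂
  rcases i with _ | i
  · rcases j with _ | _ | j <;> simp_all [replicate_succ]
  · simp [replicate_succ] at h
    exact hxy h.1.symm

/-- The word `x^N y^M` is primitive: in a nontrivial factorisation `pq`, the factor `p` starts with
`x` and `q` ends with `y`, so `qp` contains a `y` before an `x`. -/
theorem exists_eq_concat_of_commute_replicate₂ {x y : A} (hxy : x ≠ y) {N M : ℕ} (hN : 0 < N)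
    (hM : 0 < M) {u : List A}
    (h : (replicate N x ++ replicate M y) ++ u = u ++ (replicate N x ++ replicate M y)) :
    ∃ n, u = concat n fun _ => replicate N x ++ replicate M y := by
  obtain ⟨N, rfl⟩ := Nat.exists_eq_succ_of_ne_zero hN.ne'
  obtain ⟨M, rfl⟩ := Nat.exists_eq_succ_of_ne_zero hM.ne'
  refine exists_eq_concat_of_commute (by simp) (fun p q hp hq h₁ h₂ => ?_) u h
  have hp' : x ∈ p := by
    have := congrArg head? h₁
    rw [head?_append_of_ne_nil _ hp] at this
    exact mem_of_head? (by simpa [replicate_succ] using this.symm)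
  have hq' : y ∈ q := by
    have := congrArg getLast? h₁
    rw [getLast?_append_of_ne_nil _ hq, getLast?_append_of_ne_nil _ (by simp)] at this
    exact mem_of_getLast? (by simpa [getLast?_replicate] using this.symm)
  refine not_sublist_replicate_append hxy (N + 1) (M + 1) ?_
  rw [h₂]
  exact (singleton_sublist.2 hq').append (singleton_sublist.2 hp')

theorem exists_eq_replicate_append_iff {x y : A} (hxy : x ≠ y) (p : List A) :
    (∃ N M, 0 < N ∧ 0 < M ∧ p = replicate N x ++ replicate M y) ↔
      (∀ t ∈ p, t = x ∨ t = y) ∧ [x] <+ p ∧ [y] <+ p ∧ ¬ [y, x] <+ p := by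
  constructor
  · rintro ⟨N, M, hN, hM, rfl⟩
    refine ⟨fun t ht => ?_, ?_, ?_, not_sublist_replicate_append hxy _ _⟩
    · simp at ht; tauto
    · simp [hN.ne']
    · simp [hM.ne']
  · rintro ⟨h₁, h₂, h₃, h₄⟩
    obtain ⟨N, M, rfl⟩ : ∃ N M, p = replicate N x ++ replicate M y := by
      clear h₂ h₃
      induction p with
      | nil => exact ⟨0, 0, rfl⟩
      | cons t p ih =>
        rcases h₁ t (by simp) with rfl | rfl
        · obtain ⟨N, M, rfl⟩ := ih (fun s hs => h₁ s (by simp [hs])) fun h => h₄ (h.cons _)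
          exact ⟨N + 1, M, by simp [replicate_succ]⟩
        · refine ⟨0, p.length + 1, ?_⟩
          rw [replicate_succ, replicate_zero, nil_append, ← eq_replicate_of_mem]
          intro s hs
          refine (h₁ s (by simp [hs])).resolve_left fun h => h₄ ?_
          exact (singleton_sublist.2 (h ▸ hs)).cons_cons _
    refine ⟨N, M, ?_, ?_, rfl⟩
    · by_contra hN
      obtain rfl : N = 0 := by omega
      simp at h₂
      exact hxy h₂.2
    · by_contra hM
      obtain rfl : M = 0 := by omega
      simp at h₃
      exact hxy h₃.2.symm

theorem concat_const_commute (n : ℕ) (p : List A) :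
    (p ++ concat n fun _ => p) = (concat n fun _ => p) ++ p := by
  rw [← concat_succ n fun _ => p, concat_succ']

variable [DecidableEq A]

theorem count_concat (z : A) (n : ℕ) (f : ℕ → List A) :
    (concat n f).count z = ∑ t ∈ Finset.range n, (f t).count z := by
  induction n with
  | zero => simp
  | succ n ih => rw [concat_succ, count_append, ih, Finset.sum_range_succ]

theorem count_concat_snoc {z : A} {n : ℕ} {s : ℕ → List A} (hs : ∀ t, z ∉ s t) :
    (concat n fun t => s t ++ [z]).count z = n := by
  rw [count_concat]
  simp [count_append, count_eq_zero_of_not_mem (hs _)]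

/-- Both sides have exactly `n` separators, so these are matched in order and the embedding respects
blocks. -/
theorem sublist_of_concat_sublist {z : A} {n : ℕ} {s q : ℕ → List A} {r : List A}
    (hs : ∀ t, z ∉ s t) (hq : ∀ t, z ∉ q t) (hr : z ∉ r)
    (h : (concat n fun t => s t ++ [z]) <+ (concat n fun t => q t ++ [z]) ++ r) :
    ∀ t < n, s t <+ q t := by
  induction n generalizing s q with
  | zero => simp
  | succ n ih =>
    simp only [concat_succ', append_assoc, cons_append, nil_append] at h
    obtain ⟨h₁, h₂⟩ := sublist_split (hs 0) (hq 0) (by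
      rw [count_append, count_concat_snoc fun t => hs (t + 1),
        count_concat_snoc fun t => hq (t + 1), count_eq_zero_of_not_mem hr]; rfl) h
    intro t ht
    rcases t with _ | t
    · exact h₁
    · exact ih (fun t => hs (t + 1)) (fun t => hq (t + 1)) h₂ t (by omega)

theorem exists_eq_concat_of_sublist {z : A} {n : ℕ} {q : ℕ → List A} (hq : ∀ t, z ∉ q t)
    {S : List A} (h : S <+ concat n fun t => q t ++ [z]) (hc : S.count z = n) :
    ∃ s : ℕ → List A, S = (concat n fun t => s t ++ [z]) ∧ ∀ t, s t <+ q t := by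
  induction n generalizing S with
  | zero =>
    exact ⟨fun _ => [], by simpa using h, fun t => by simp⟩
  | succ n ih =>
    rw [concat_succ] at h
    obtain ⟨S₁, S₂, rfl, h₁, h₂⟩ := sublist_append_iff.1 h
    obtain ⟨S₃, S₄, rfl, h₃, h₄⟩ := sublist_append_iff.1 h₂
    have c₁ := h₁.count_le z
    have c₃ : S₃.count z = 0 := count_eq_zero_of_not_mem fun hz => hq n (h₃.subset hz)
    rw [count_concat_snoc hq] at c₁
    rcases sublist_singleton.1 h₄ with rfl | rfl
    · simp [c₃] at hc
      omega
    · simp [c₃] at hc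
      obtain ⟨s, rfl, hs⟩ := ih h₁ hc
      refine ⟨Function.update s n S₃, ?_, fun t => ?_⟩
      · rw [concat_succ, Function.update_self]
        congr 1
        exact concat_congr fun t ht => by rw [Function.update_of_ne ht.ne]
      · rcases eq_or_ne t n with rfl | ht
        · rwa [Function.update_self]
        · rw [Function.update_of_ne ht]
          exact hs t

theorem count_enc_sep {x z : A} (h : x ≠ z) (n : ℕ) (f : ℕ → ℕ) : (enc x z n f).count z = n :=
  count_concat_snoc fun t => by simp [h.symm]

theorem count_enc {x z : A} (h : x ≠ z) (n : ℕ) (f : ℕ → ℕ) :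
    (enc x z n f).count x = ∑ t ∈ Finset.range n, f t := by
  rw [enc, count_concat]
  simp [count_append, h.symm]

theorem enc_inj {x z : A} (h : x ≠ z) {n m : ℕ} {f g : ℕ → ℕ} (he : enc x z n f = enc x z m g) :
    n = m ∧ ∀ t < n, f t = g t := by
  have hn : n = m := by rw [← count_enc_sep h n f, he, count_enc_sep h]
  subst hn
  refine ⟨rfl, fun t ht => ?_⟩
  have key : ∀ {f g : ℕ → ℕ}, enc x z n f = enc x z n g → f t ≤ g t := fun {f g} he => by
    have hsub : enc x z n f <+ enc x z n g := by rw [he]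
    have hz : ∀ f : ℕ → ℕ, ∀ t, z ∉ replicate (f t) x := by simp [h.symm]
    have := sublist_of_concat_sublist (r := []) (hz _) (hz _) (by simp)
      (hsub.trans (sublist_append_left _ _)) t ht
    simpa using this.length_le
  exact le_antisymm (key he) (key he.symm)

/-- The test for membership in `{x, y}`. -/
def onPair (x y t : A) : Bool := decide (t = x ∨ t = y)

theorem onPair_comm (x y : A) : onPair x y = onPair y x := by
  funext t; simp [onPair, or_comm]

/-- A word is determined by its projections to pairs of letters. -/
theorem eq_of_filter_onPair {S : Set A} (hS : ∀ y ∈ S, ∃ x ∈ S, x ≠ y) {u v : List A}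
    (hu : ∀ y ∈ u, y ∈ S) (hv : ∀ y ∈ v, y ∈ S)
    (h : ∀ x ∈ S, ∀ y ∈ S, x ≠ y → u.filter (onPair x y) = v.filter (onPair x y)) : u = v := by
  induction u generalizing v with
  | nil =>
    rcases v with _ | ⟨y, v⟩
    · rfl
    · obtain ⟨x, hx, hxy⟩ := hS y (hv y (by simp))
      simpa [onPair] using h x hx y (hv y (by simp)) hxy
  | cons x u ih =>
    rcases v with _ | ⟨y, v⟩
    · obtain ⟨y, hy, hxy⟩ := hS x (hu x (by simp))
      simpa [onPair] using h y hy x (hu x (by simp)) hxy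
    · have hxy : x = y := by
        by_contra hne
        have := h x (hu x (by simp)) y (hv y (by simp)) hne
        simp [onPair] at this
        exact hne this.1
      subst hxy
      congr 1
      refine ih (fun y hy => hu y (by simp [hy])) (fun y hy => hv y (by simp [hy])) ?_
      intro a ha b hb hab
      have := h a ha b hb hab
      rw [filter_cons, filter_cons] at this
      split_ifs at this
      · simpa using this
      · exact this

/-- The words in `(x*y*z)*`. -/
def Sorted (x y z : A) (S : List A) : Prop :=
  ∃ (n : ℕ) (i j : ℕ → ℕ), S = concat n fun t => replicate (i t) x ++ replicate (j t) y ++ [z]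

/-- The words `(x^N y^M z)^n` with `N` and `M` positive. -/
def SortedPower (x y z : A) (Q : List A) : Prop :=
  ∃ n N M : ℕ, 0 < N ∧ 0 < M ∧ Q = concat n fun _ => replicate N x ++ replicate M y ++ [z]

/-- A subword of `(x^N y^M z)^n` that keeps every `z` has one subword of `x^N y^M` in each block. -/
theorem sorted_iff {x y z : A} (hxz : x ≠ z) (hyz : y ≠ z) (S : List A) :
    Sorted x y z S ↔ ∃ Q, SortedPower x y z Q ∧ S <+ Q ∧ S.count z = Q.count z := by
  constructor
  · rintro ⟨n, i, j, rfl⟩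
    -- The sums bound all exponents, and the added `1` makes the bounds positive.
    refine ⟨_, ⟨n, (∑ t ∈ Finset.range n, i t) + 1, (∑ t ∈ Finset.range n, j t) + 1, by simp,
      by simp, rfl⟩, concat_sublist fun t ht => ?_, ?_⟩
    · have hi := Finset.single_le_sum (f := i) (fun _ _ => Nat.zero_le _) (Finset.mem_range.2 ht)
      have hj := Finset.single_le_sum (f := j) (fun _ _ => Nat.zero_le _) (Finset.mem_range.2 ht)
      refine Sublist.append (Sublist.append ?_ ?_) (Sublist.refl _) <;>
        rw [replicate_sublist_replicate] <;> omega
    · rw [count_concat_snoc, count_concat_snoc] <;> simp [hxz.symm, hyz.symm]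
  · rintro ⟨Q, ⟨n, N, M, -, -, rfl⟩, h, hc⟩
    have hz : ∀ t : ℕ, z ∉ replicate N x ++ replicate M y := by simp [hxz.symm, hyz.symm]
    rw [count_concat_snoc hz] at hc
    obtain ⟨s, rfl, hs⟩ := exists_eq_concat_of_sublist hz h hc
    have : ∀ t, ∃ i j, s t = replicate i x ++ replicate j y := fun t => by
      obtain ⟨l₁, l₂, h, h₁, h₂⟩ := sublist_append_iff.1 (hs t)
      obtain ⟨i, -, rfl⟩ := sublist_replicate_iff.1 h₁
      obtain ⟨j, -, rfl⟩ := sublist_replicate_iff.1 h₂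
      exact ⟨i, j, h⟩
    choose i j hij using this
    exact ⟨n, i, j, by simp only [hij]⟩

/-- The word `x^N z` is primitive: two commuting nonempty factors would both end with `z`, which
occurs only once. -/
theorem exists_eq_concat_of_commute_replicate {x z : A} (hxz : x ≠ z) {N : ℕ} {u : List A}
    (h : (replicate N x ++ [z]) ++ u = u ++ (replicate N x ++ [z])) :
    ∃ n, u = enc x z n fun _ => N := by
  refine exists_eq_concat_of_commute (by simp) (fun p q hp hq h₁ h₂ => ?_) u h
  have hp' : z ∈ p := by
    have := congrArg getLast? h₂
    rw [getLast?_append_of_ne_nil _ hp, getLast?_append_of_ne_nil _ (by simp)] at this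
    exact mem_of_getLast? this.symm
  have hq' : z ∈ q := by
    have := congrArg getLast? h₁
    rw [getLast?_append_of_ne_nil _ hq, getLast?_append_of_ne_nil _ (by simp)] at this
    exact mem_of_getLast? this.symm
  have h₃ := congrArg (count z) h₁
  have := count_pos_iff.2 hp'
  have := count_pos_iff.2 hq'
  rw [count_append, count_append, count_eq_zero_of_not_mem (by simp [hxz.symm])] at h₃
  simp at h₃
  omega

/-- Concatenation is definable only next to an absent letter, so `Q` is tested through its three
projections to pairs. Each is a power of a primitive word, and together they determine `Q`. -/
theorem sortedPower_iff {x y z : A} (hxy : x ≠ y) (hxz : x ≠ z) (hyz : y ≠ z) (Q : List A) :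
    SortedPower x y z Q ↔ (∀ t ∈ Q, t ∈ ({x, y, z} : Set A)) ∧
      ∃ p₁, (∃ N, p₁ = replicate N x ++ z :: replicate 0 x) ∧
      ∃ p₂, (∃ M, p₂ = replicate M y ++ z :: replicate 0 y) ∧
      ∃ p₃, (∃ N M, 0 < N ∧ 0 < M ∧ p₃ = replicate N x ++ replicate M y) ∧
      p₃.count x = p₁.count x ∧ p₃.count y = p₂.count y ∧
      (∃ q, q = Q.filter (onPair x z) ∧ y ∉ p₁ ∧ y ∉ q ∧ p₁ ++ q = q ++ p₁) ∧
      (∃ q, q = Q.filter (onPair y z) ∧ x ∉ p₂ ∧ x ∉ q ∧ p₂ ++ q = q ++ p₂) ∧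
      (∃ q, q = Q.filter (onPair x y) ∧ z ∉ p₃ ∧ z ∉ q ∧ p₃ ++ q = q ++ p₃) := by
  have hf₁ : ∀ n N M : ℕ,
      (concat n fun _ => replicate N x ++ replicate M y ++ [z]).filter (onPair x z) =
        concat n fun _ => replicate N x ++ [z] := fun n N M => by
    simp [filter_concat, onPair, hxy.symm, hyz]
  have hf₂ : ∀ n N M : ℕ,
      (concat n fun _ => replicate N x ++ replicate M y ++ [z]).filter (onPair y z) =
        concat n fun _ => replicate M y ++ [z] := fun n N M => by
    simp [filter_concat, onPair, hxy, hxz]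
  have hf₃ : ∀ n N M : ℕ,
      (concat n fun _ => replicate N x ++ replicate M y ++ [z]).filter (onPair x y) =
        concat n fun _ => replicate N x ++ replicate M y := fun n N M => by
    simp [filter_concat, onPair, hxz.symm, hyz.symm]
  constructor
  · rintro ⟨n, N, M, hN, hM, rfl⟩
    refine ⟨fun t ht => ?_, _, ⟨N, rfl⟩, _, ⟨M, rfl⟩, _, ⟨N, M, hN, hM, rfl⟩, ?_, ?_,
      ⟨_, rfl, ?_, ?_, ?_⟩, ⟨_, rfl, ?_, ?_, ?_⟩, ⟨_, rfl, ?_, ?_, ?_⟩⟩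
    · obtain ⟨-, -, ht⟩ := mem_concat.1 ht
      simp at ht ⊢; tauto
    · simp [count_append, count_replicate, hxy.symm, hxz.symm]
    · simp [count_append, count_replicate, hxy, hyz.symm]
    · simp [hxy.symm, hyz]
    · simp [onPair, hxy.symm, hyz]
    · rw [hf₁]; exact concat_const_commute _ _
    · simp [hxy, hxz]
    · simp [onPair, hxy, hxz]
    · rw [hf₂]; exact concat_const_commute _ _
    · simp [hyz.symm, hxz.symm]
    · simp [onPair, hyz.symm, hxz.symm]
    · rw [hf₃]; exact concat_const_commute _ _
  · rintro ⟨hQ, _, ⟨N, rfl⟩, _, ⟨M, rfl⟩, _, ⟨N', M', hN, hM, rfl⟩, h₁, h₂, ⟨_, rfl, -, -, h₃⟩,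
      ⟨_, rfl, -, -, h₄⟩, ⟨_, rfl, -, -, h₅⟩⟩
    obtain rfl : N' = N := by
      simpa [count_append, count_replicate, hxy.symm, hxz.symm] using h₁
    obtain rfl : M' = M := by
      simpa [count_append, count_replicate, hxy, hyz.symm] using h₂
    obtain ⟨n, hn⟩ := exists_eq_concat_of_commute_replicate hxz h₃
    obtain ⟨n', hn'⟩ := exists_eq_concat_of_commute_replicate hyz h₄
    obtain ⟨k, hk⟩ := exists_eq_concat_of_commute_replicate₂ hxy hN hM h₅
    have e₁ := congrArg (count z) hn
    have e₂ := congrArg (count z) hn'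
    have e₃ := congrArg (count x) hn
    have e₄ := congrArg (count x) hk
    rw [count_filter (by simp [onPair]), count_enc_sep hxz] at e₁
    rw [count_filter (by simp [onPair]), count_enc_sep hyz] at e₂
    rw [count_filter (by simp [onPair]), count_enc hxz] at e₃
    rw [count_filter (by simp [onPair]), count_concat] at e₄
    obtain rfl : n' = n := by omega
    -- Counting `x` compares the two numbers of blocks, because `N'` is positive.
    obtain rfl : k = n' := by
      simp [count_append, count_replicate, hxy.symm] at e₃ e₄
      rw [e₃] at e₄
      exact (Nat.eq_of_mul_eq_mul_right hN e₄).symm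
    refine ⟨k, N', M', hN, hM, eq_of_filter_onPair (S := {x, y, z}) ?_ hQ ?_ ?_⟩
    · rintro t (rfl | rfl | rfl)
      · exact ⟨y, by simp, hxy.symm⟩
      · exact ⟨x, by simp, hxy⟩
      · exact ⟨x, by simp, hxz⟩
    · intro t ht
      obtain ⟨-, -, ht⟩ := mem_concat.1 ht
      simp at ht ⊢; tauto
    · have g₁ := hn.trans (hf₁ k N' M').symm
      have g₂ := hn'.trans (hf₂ k N' M').symm
      have g₃ := hk.trans (hf₃ k N' M').symm
      rintro s (rfl | rfl | rfl) t (rfl | rfl | rfl) hst <;>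
        first
        | exact absurd rfl hst
        | exact g₁
        | exact g₂
        | exact g₃
        | (rw [onPair_comm]; first | exact g₁ | exact g₂ | exact g₃)

end Blocks

/-! ### Definability of commutation and of sorted words. -/

namespace Definable

variable {A : Type u} [Finite A] {α : Type}

theorem only (S : Set A) (i : α) : Definable fun v : α → List A => ∀ y ∈ v i, y ∈ S :=
  (all fun y => (const (y ∈ S)).or (not_const_sub [y] i)).congr fun v => by
    simp only [singleton_sublist]
    exact forall_congr' fun y => by tauto

theorem replicateAppendReplicate {x y : A} (hxy : x ≠ y) (i : α) :
    Definable fun v : α → List A =>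
      ∃ N M, 0 < N ∧ 0 < M ∧ v i = replicate N x ++ replicate M y :=
  ((only {x, y} _).and <| (const_sub _ _).and <| (const_sub _ _).and (not_const_sub _ _)).congr
    fun _ => exists_eq_replicate_append_iff hxy _

variable [DecidableEq A] [Nontrivial A]

theorem commute (c : A) (i j : α) :
    Definable fun v : α → List A => c ∉ v i ∧ c ∉ v j ∧ v i ++ v j = v j ++ v i :=
  (ex (P := fun v w => (c ∉ v i ∧ c ∉ v j ∧ w = v i ++ v j) ∧ (c ∉ v j ∧ c ∉ v i ∧ w = v j ++ v i))
    ((append _ _ _ _).and (append _ _ _ _))).congr fun v => by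
    constructor
    · rintro ⟨h₁, h₂, h⟩
      exact ⟨_, ⟨h₁, h₂, rfl⟩, h₂, h₁, h⟩
    · rintro ⟨w, ⟨h₁, h₂, rfl⟩, -, -, h⟩
      exact ⟨h₁, h₂, h⟩

theorem sortedPower {x y z : A} (hxy : x ≠ y) (hxz : x ≠ z) (hyz : y ≠ z) (i : α) :
    Definable fun v : α → List A => SortedPower x y z (v i) :=
  ((only _ _).and <| ex <| (replicateAppend hxz _ _).and <| ex <|
    (replicateAppend hyz _ _).and <| ex <| (replicateAppendReplicate hxy _).and <|
    (countEq _ _ _).and <| (countEq _ _ _).and <| (ex <| (filter _ _ _).and (commute _ _ _)).and <|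
    (ex <| (filter _ _ _).and (commute _ _ _)).and (ex <| (filter _ _ _).and (commute _ _ _))).congr
    fun _ => sortedPower_iff hxy hxz hyz _

theorem sorted {x y z : A} (hxy : x ≠ y) (hxz : x ≠ z) (hyz : y ≠ z) (i : α) :
    Definable fun v : α → List A => Sorted x y z (v i) :=
  (ex <| (sortedPower hxy hxz hyz _).and <| (sub _ _).and (countEq _ _ _)).congr fun _ =>
    sorted_iff hxz hyz _

end Definable


/-! ### Pointwise addition and disjointness of coded sequences. -/

section Sequences

variable {A : Type u} [DecidableEq A]

/-- The substitution `a ↦ ac`. -/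
def double (a c t : A) : List A := if t = a then [a, c] else [t]

/-- The substitution `a ↦ c`. -/
def rename (a c t : A) : A := if t = a then c else t

theorem flatMap_double_replicate {a b c : A} (hab : a ≠ b) (n : ℕ) :
    (replicate n b).flatMap (double a c) = replicate n b := by
  induction n with
  | zero => rfl
  | succ n ih => simp [replicate_succ, ih, double, hab.symm]

/-- In a word with blocks `b^i a^j c`, the projection to `a`, `c` being a power of `ac` forces every
`j` to be `1`; the projection to `a`, `b` then fixes the rest. The extra final `a` ensures that the
last block is closed by a `c`. -/
theorem eq_flatMap_double_iff {a b c : A} (hab : a ≠ b) (hac : a ≠ c) (hbc : b ≠ c)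
    (X Y : List A) :
    ((∀ y ∈ X, y ∈ ({a, b} : Set A)) ∧ Y = (X ++ [a]).flatMap (double a c)) ↔
      (∀ y ∈ X, y ∈ ({a, b} : Set A)) ∧ (∃ p, p = [a] ∧ ∃ E, (c ∉ X ∧ c ∉ p ∧ E = X ++ p) ∧
        E = Y.filter (onPair a b)) ∧
      (∃ p, p = [a, c] ∧ ∃ P, P = Y.filter (onPair a c) ∧ b ∉ p ∧ b ∉ P ∧ p ++ P = P ++ p) ∧
      Sorted b a c Y := by
  constructor
  · rintro ⟨hX, rfl⟩
    have hcX : c ∉ X := fun h => by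
      rcases hX c h with h | h
      · exact hac h.symm
      · exact hbc h.symm
    obtain ⟨n, f, hf⟩ := exists_append_eq_enc (x := b) (z := a) (w := X) fun y hy => by
      simpa [or_comm] using hX y hy
    have hY : (X ++ [a]).flatMap (double a c) =
        concat (n + 1) fun t => replicate (f t) b ++ replicate 1 a ++ [c] := by
      rw [hf, enc, flatMap_concat]
      refine concat_congr fun t _ => ?_
      rw [flatMap_append, flatMap_double_replicate hab]
      simp [double]
    refine ⟨hX, ⟨_, rfl, _, ⟨hcX, by simp [hac.symm], rfl⟩, ?_⟩, ⟨_, rfl, _, rfl, ?_, ?_, ?_⟩, ?_⟩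
    · rw [hY, hf, enc, filter_concat]
      refine concat_congr fun t _ => ?_
      simp [onPair, hac.symm, hbc.symm]
    · simp [hab.symm, hbc]
    · simp [onPair, hab.symm, hbc]
    · have : ((X ++ [a]).flatMap (double a c)).filter (onPair a c) =
          concat (n + 1) fun _ => [a, c] := by
        rw [hY, filter_concat]
        refine concat_congr fun t _ => ?_
        simp [onPair, hab.symm, hbc]
      rw [this]
      exact concat_const_commute _ _
    · exact ⟨_, _, _, hY⟩
  · rintro ⟨hX, ⟨_, rfl, _, ⟨-, -, rfl⟩, hE⟩, ⟨_, rfl, _, rfl, -, -, hP⟩, n, i, j, rfl⟩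
    refine ⟨hX, ?_⟩
    obtain ⟨m, hm⟩ := exists_eq_concat_of_commute_replicate (x := a) (z := c) (N := 1) hac hP
    have h₁ : (concat n fun t => replicate (i t) b ++ replicate (j t) a ++ [c]).filter
        (onPair a c) = enc a c n j := by
      rw [filter_concat]
      refine concat_congr fun t _ => ?_
      simp [onPair, hab.symm, hbc]
    obtain ⟨rfl, hj⟩ := enc_inj hac (h₁.symm.trans hm)
    rw [hE, filter_concat, flatMap_concat]
    refine concat_congr fun t ht => ?_
    rw [hj t ht]
    simp [onPair, hac.symm, hbc.symm, flatMap_double_replicate hab, double]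

theorem filter_flatMap_double {a b c : A} (hab : a ≠ b) (hac : a ≠ c)
    {X : List A} (hX : ∀ y ∈ X, y ∈ ({a, b} : Set A)) :
    ((X ++ [a]).flatMap (double a c)).filter (onPair b c) = X.map (rename a c) ++ [c] := by
  induction X with
  | nil => simp [double, onPair, hab, hac]
  | cons y X ih =>
    have := ih fun y hy => hX y (by simp [hy])
    rcases hX y (by simp) with rfl | rfl
    · simp_all [double, onPair, rename]
    · simp_all [double, onPair, rename, hab.symm]

/-- After a `c` is placed behind each `a`, deleting the letters `a` leaves the renamed word,
followed by the `c` of the auxiliary last letter. -/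
theorem eq_map_rename_iff {a b c : A} (hab : a ≠ b) (hac : a ≠ c) (X X' : List A) :
    ((∀ y ∈ X, y ∈ ({a, b} : Set A)) ∧ X' = X.map (rename a c)) ↔
      ∃ Y, ((∀ y ∈ X, y ∈ ({a, b} : Set A)) ∧ Y = (X ++ [a]).flatMap (double a c)) ∧
        ∃ E, E = Y.filter (onPair b c) ∧ ∃ p, p = [c] ∧ (a ∉ X' ∧ a ∉ p ∧ E = X' ++ p) := by
  constructor
  · rintro ⟨hX, rfl⟩
    refine ⟨_, ⟨hX, rfl⟩, _, rfl, _, rfl, ?_, by simp [hac], filter_flatMap_double hab hac hX⟩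
    simp only [mem_map, rename, not_exists, not_and]
    intro y _
    split_ifs with h
    · exact hac.symm
    · exact h
  · rintro ⟨_, ⟨hX, rfl⟩, _, rfl, _, rfl, -, -, h⟩
    rw [filter_flatMap_double hab hac hX] at h
    exact ⟨hX, (append_cancel_right h).symm⟩

theorem map_rename_enc {a b c : A} (hab : a ≠ b) (n : ℕ) (f : ℕ → ℕ) :
    (enc a b n f).map (rename a c) = enc c b n f := by
  rw [enc, map_concat]
  refine concat_congr fun t _ => ?_
  simp [rename, hab.symm]

/-- The words `x^(i 0) y^(j 0) z ⋯` arising from two sequences. -/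
def join (x y z : A) (n : ℕ) (i j : ℕ → ℕ) : List A :=
  concat n fun t => replicate (i t) x ++ replicate (j t) y ++ [z]

theorem filter_join_right {x y z : A} (hxy : x ≠ y) (hxz : x ≠ z) (n : ℕ) (i j : ℕ → ℕ) :
    (join x y z n i j).filter (onPair y z) = enc y z n j := by
  rw [join, filter_concat]
  exact concat_congr fun t _ => by simp [onPair, hxy, hxz]

theorem filter_join_left {x y z : A} (hxy : x ≠ y) (hyz : y ≠ z) (n : ℕ) (i j : ℕ → ℕ) :
    (join x y z n i j).filter (onPair x z) = enc x z n i := by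
  rw [join, filter_concat]
  exact concat_congr fun t _ => by simp [onPair, hxy.symm, hyz]

/-- This turns addition into embedding: since `c` comes last in `ac`, each `c` and each `a` of `c^i
a^j` uses up a copy of its own. -/
theorem replicate_append_sublist_concat_iff {a c : A} (hac : a ≠ c) (i j k : ℕ) :
    (replicate i c ++ replicate j a <+ concat k fun _ => [a, c]) ↔ i + j ≤ k := by
  constructor
  · intro h
    induction k generalizing i with
    | zero => simp at h; simp [h]
    | succ k ih =>
      rcases i with _ | i
      · have := h.count_le a
        rw [count_concat] at this
        simpa [hac.symm] using this
      · rw [concat_succ', replicate_succ] at h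
        simp only [cons_append, nil_append] at h
        have h₁ := h.of_cons_of_ne hac.symm
        have := ih i (by simpa using h₁)
        omega
  · intro h
    obtain ⟨l, rfl⟩ := Nat.exists_eq_add_of_le h
    rw [add_assoc, concat_add]
    refine Sublist.append ?_ ?_ <;> rw [replicate_sublist_iff, count_concat] <;>
      simp [hac, hac.symm]

theorem flatMap_double_replicate_self (a c : A) (n : ℕ) :
    (replicate n a).flatMap (double a c) = concat n fun _ => [a, c] := by
  induction n with
  | zero => rfl
  | succ n ih => simp [replicate_succ, ih, double, concat_succ']

theorem flatMap_double_enc {a b c : A} (hab : a ≠ b) (n : ℕ) (f : ℕ → ℕ) :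
    (enc a b n f).flatMap (double a c) = concat n fun t => (concat (f t) fun _ => [a, c]) ++ [b] := by
  rw [enc, flatMap_concat]
  refine concat_congr fun t _ => ?_
  rw [flatMap_append, flatMap_double_replicate_self]
  simp [double, hab.symm]

/-- The word `S` interleaves the sequences `f` of `X` and `g` of `Y` into blocks `c^(g t) a^(f t)
b`. Its embedding into the word with blocks `(ac)^(h t) b`, where `h` is the sequence of `Z`, gives
`f + g ≤ h` pointwise, and equal totals of `a` turn this into equality. -/
theorem enc_add_iff {a b c : A} (hab : a ≠ b) (hac : a ≠ c) (hbc : b ≠ c) (X Y Z : List A) :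
    (∃ n f g, X = enc a b n f ∧ Y = enc a b n g ∧ Z = enc a b n (fun t => f t + g t)) ↔
      (∃ n f, Z = enc a b n f) ∧ (∃ n f, Y = enc a b n f) ∧
      ∃ Y', ((∀ y ∈ Y, y ∈ ({a, b} : Set A)) ∧ Y' = Y.map (rename a c)) ∧
      ∃ S, Sorted c a b S ∧ X = S.filter (onPair a b) ∧ Y' = S.filter (onPair c b) ∧
      S.count b = Z.count b ∧
      (∃ Z', ((∀ y ∈ Z, y ∈ ({a, b} : Set A)) ∧ Z' = (Z ++ [a]).flatMap (double a c)) ∧ S <+ Z') ∧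
      ∃ W, (c ∉ X ∧ c ∉ Y ∧ W = X ++ Y) ∧ W.count a = Z.count a := by
  have hmem : ∀ n f, ∀ y ∈ enc a b n f, y ∈ ({a, b} : Set A) := fun n f y hy => mem_enc hy
  have hc : ∀ n f, c ∉ enc a b n f := fun n f h => by
    rcases mem_enc h with h | h
    · exact hac h.symm
    · exact hbc h.symm
  have hS : ∀ (n : ℕ) (i j : ℕ → ℕ), (join c a b n i j).count b = n := fun n i j =>
    count_concat_snoc fun t => by simp [hab.symm, hbc]
  constructor
  · rintro ⟨n, f, g, rfl, rfl, rfl⟩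
    refine ⟨⟨_, _, rfl⟩, ⟨_, _, rfl⟩, _, ⟨hmem _ _, rfl⟩, join c a b n g f, ⟨n, g, f, rfl⟩,
      (filter_join_right hac.symm hbc.symm _ _ _).symm, ?_, ?_, ⟨_, ⟨hmem _ _, rfl⟩, ?_⟩,
      _, ⟨hc _ _, hc _ _, rfl⟩, ?_⟩
    · rw [filter_join_left hac.symm hab, map_rename_enc hab]
    · rw [hS, count_enc_sep hab]
    · rw [flatMap_append, flatMap_double_enc hab]
      refine Sublist.trans (concat_sublist fun t _ => ?_) (sublist_append_left _ _)
      refine Sublist.append ?_ (Sublist.refl _)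
      rw [replicate_append_sublist_concat_iff hac]
      omega
    · rw [count_append, count_enc hab, count_enc hab, count_enc hab, Finset.sum_add_distrib]
  · rintro ⟨⟨m, h, rfl⟩, ⟨k, g, rfl⟩, _, ⟨-, rfl⟩, _, ⟨n, i, j, rfl⟩, hX, hY, hb, ⟨_, ⟨-, rfl⟩, hs⟩,
      _, ⟨-, -, rfl⟩, ha⟩
    change X = (join c a b n i j).filter _ at hX
    change _ = (join c a b n i j).filter _ at hY
    change (join c a b n i j).count b = _ at hb
    rw [filter_join_right hac.symm hbc.symm] at hX
    rw [filter_join_left hac.symm hab, map_rename_enc hab] at hY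
    rw [hS, count_enc_sep hab] at hb
    subst hb hX
    obtain ⟨rfl, hg⟩ := enc_inj hbc.symm hY
    rw [flatMap_append, flatMap_double_enc hab] at hs
    have hle : ∀ t < k, i t + j t ≤ h t := fun t ht => by
      rw [← replicate_append_sublist_concat_iff hac]
      refine sublist_of_concat_sublist (z := b) (fun t => ?_) (fun t => ?_) ?_ hs t ht
      · simp [hab.symm, hbc]
      · simp [mem_concat, hab.symm, hbc]
      · simp [double, hab.symm, hbc]
    rw [count_append, count_enc hab, count_enc hab, count_enc hab, ← Finset.sum_add_distrib] at ha
    refine ⟨k, j, g, rfl, rfl, enc_congr ?_⟩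
    have := (Finset.sum_eq_sum_iff_of_le (s := Finset.range k) (f := fun t => j t + g t) (g := h)
      (fun t ht => by
        have ht := Finset.mem_range.1 ht
        have := hle t ht
        have := hg t ht
        omega)).1 ha
    exact fun t ht => (this t (Finset.mem_range.2 ht)).symm

/-- A block is of both forms `c*a*` and `a*c*` exactly when one of the two letters is missing from
it. -/
theorem enc_disjoint_iff {a b c : A} (hab : a ≠ b) (hac : a ≠ c) (hbc : b ≠ c) (X Y : List A) :
    (∃ n f g, X = enc a b n f ∧ Y = enc a b n g ∧ ∀ t < n, f t = 0 ∨ g t = 0) ↔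
      (∃ n f, Y = enc a b n f) ∧
      ∃ Y', ((∀ y ∈ Y, y ∈ ({a, b} : Set A)) ∧ Y' = Y.map (rename a c)) ∧
      ∃ S, Sorted c a b S ∧ Sorted a c b S ∧ X = S.filter (onPair a b) ∧
        Y' = S.filter (onPair c b) := by
  have hmem : ∀ n f, ∀ y ∈ enc a b n f, y ∈ ({a, b} : Set A) := fun n f y hy => mem_enc hy
  constructor
  · rintro ⟨n, f, g, rfl, rfl, h⟩
    refine ⟨⟨_, _, rfl⟩, _, ⟨hmem _ _, rfl⟩, join c a b n g f, ⟨n, g, f, rfl⟩, ⟨n, f, g, ?_⟩,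
      (filter_join_right hac.symm hbc.symm _ _ _).symm, ?_⟩
    · refine concat_congr fun t ht => ?_
      rcases h t ht with h | h <;> simp [h]
    · rw [filter_join_left hac.symm hab, map_rename_enc hab]
  · rintro ⟨⟨k, g, rfl⟩, _, ⟨-, rfl⟩, _, ⟨n, i, j, rfl⟩, ⟨m, i', j', h⟩, hX, hY⟩
    change X = (join c a b n i j).filter _ at hX
    change _ = (join c a b n i j).filter _ at hY
    change join c a b n i j = join a c b m i' j' at h
    rw [filter_join_right hac.symm hbc.symm] at hX
    rw [filter_join_left hac.symm hab, map_rename_enc hab] at hY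
    subst hX
    obtain ⟨rfl, hg⟩ := enc_inj hbc.symm hY
    refine ⟨k, j, g, rfl, rfl, fun t ht => ?_⟩
    rw [hg t ht]
    obtain rfl : k = m := by
      have := congrArg (count b) h
      rwa [join, join, count_concat_snoc, count_concat_snoc] at this <;>
        simp [hab.symm, hbc]
    have hsub : join c a b k i j <+ join a c b k i' j' := by rw [h]
    have := sublist_of_concat_sublist (z := b) (r := []) (fun t => by simp [hab.symm, hbc])
      (fun t => by simp [hab.symm, hbc]) (by simp)
      (hsub.trans (sublist_append_left _ _)) t ht
    by_contra hne
    push Not at hne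
    refine not_sublist_replicate_append hac (i' t) (j' t) (Sublist.trans ?_ this)
    exact Sublist.append (l₁ := [c]) (singleton_sublist.2 (by simp [hne.2]))
      (singleton_sublist.2 (by simp [hne.1]))

end Sequences

/-! ### Definability of sequences and their pointwise operations. -/

namespace Definable

variable {A : Type u} [Finite A] [DecidableEq A] [Nontrivial A] {α : Type}

theorem flatMapDouble {a b c : A} (hab : a ≠ b) (hac : a ≠ c) (hbc : b ≠ c) (i j : α) :
    Definable fun v : α → List A =>
      (∀ y ∈ v i, y ∈ ({a, b} : Set A)) ∧ v j = (v i ++ [a]).flatMap (double a c) :=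
  ((only _ _).and <|
    (ex <| (eq_const _ _).and <| ex <| (append _ _ _ _).and (filter _ _ _)).and <|
    (ex <| (eq_const _ _).and <| ex <| (filter _ _ _).and (commute _ _ _)).and <|
    sorted hab.symm hbc hac _).congr fun _ => eq_flatMap_double_iff hab hac hbc _ _

theorem mapRename {a b c : A} (hab : a ≠ b) (hac : a ≠ c) (hbc : b ≠ c) (i j : α) :
    Definable fun v : α → List A =>
      (∀ y ∈ v i, y ∈ ({a, b} : Set A)) ∧ v j = (v i).map (rename a c) :=
  (ex <| (flatMapDouble hab hac hbc _ _).and <| ex <| (filter _ _ _).and <| ex <|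
    (eq_const _ _).and (append _ _ _ _)).congr fun _ => eq_map_rename_iff hab hac _ _

theorem enc {a b c : A} (hac : a ≠ c) (hbc : b ≠ c) (i : α) :
    Definable fun v : α → List A => ∃ n f, v i = enc a b n f := by
  refine ((eq_const i []).or <| ex (P := fun v w => (∀ y ∈ w, y ∈ ({a, b} : Set A)) ∧
    ∃ p, p = [b] ∧ (c ∉ w ∧ c ∉ p ∧ v i = w ++ p)) <| (only _ _).and <| ex <|
    (eq_const _ _).and (append _ _ _ _)).congr fun v => ?_
  rw [exists_eq_enc_iff]
  refine or_congr Iff.rfl (exists_congr fun w => and_congr_right fun hw => ?_)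
  simp only [exists_eq_left]
  refine ⟨fun h => ⟨fun hc => ?_, by simp [hbc.symm], h⟩, fun h => h.2.2⟩
  rcases hw c hc with h | h
  · exact hac h.symm
  · exact hbc h.symm

theorem encAdd {a b c : A} (hab : a ≠ b) (hac : a ≠ c) (hbc : b ≠ c) (i j k : α) :
    Definable fun v : α → List A => ∃ n f g, v i = Subword.enc a b n f ∧
      v j = Subword.enc a b n g ∧ v k = Subword.enc a b n (fun t => f t + g t) :=
  ((enc hac hbc _).and <| (enc hac hbc _).and <| ex <| (mapRename hab hac hbc _ _).and <| ex <|
    (sorted hac.symm hbc.symm hab _).and <| (filter _ _ _).and <| (filter _ _ _).and <|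
    (countEq _ _ _).and <| (ex <| (flatMapDouble hab hac hbc _ _).and (sub _ _)).and <| ex <|
    (append _ _ _ _).and (countEq _ _ _)).congr fun _ => enc_add_iff hab hac hbc _ _ _

theorem encDisjoint {a b c : A} (hab : a ≠ b) (hac : a ≠ c) (hbc : b ≠ c) (i j : α) :
    Definable fun v : α → List A => ∃ n f g, v i = Subword.enc a b n f ∧
      v j = Subword.enc a b n g ∧ ∀ t < n, f t = 0 ∨ g t = 0 :=
  ((enc hac hbc _).and <| ex <| (mapRename hab hac hbc _ _).and <| ex <|
    (sorted hac.symm hbc.symm hab _).and <| (sorted hac hab hbc.symm _).and <|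
    (filter _ _ _).and (filter _ _ _)).congr fun _ => enc_disjoint_iff hab hac hbc _ _

/-- The constant sequences whose value is a fixed number. -/
theorem encConst {a b c : A} (hab : a ≠ b) (hac : a ≠ c) (hbc : b ≠ c) (m : ℕ) (i : α) :
    Definable fun v : α → List A => ∃ n, v i = Subword.enc a b n fun _ => m := by
  refine (ex (P := fun v p => p = replicate m a ++ [b] ∧ c ∉ p ∧ c ∉ v i ∧ p ++ v i = v i ++ p) <|
    (eq_const _ _).and (commute _ _ _)).congr fun v => ?_
  constructor
  · rintro ⟨n, h⟩
    refine ⟨_, rfl, by simp [hac.symm, hbc.symm], fun hc => ?_, ?_⟩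
    · rw [h] at hc
      rcases mem_enc hc with h | h
      · exact hac h.symm
      · exact hbc h.symm
    · rw [h]
      exact concat_const_commute _ _
  · rintro ⟨_, rfl, -, -, h⟩
    exact exists_eq_concat_of_commute_replicate hab h

end Definable

/-- The letters `a`, `b` and `c` are distinct. -/
structure Distinct {A : Type u} (a b c : A) : Prop where
  ab : a ≠ b
  ac : a ≠ c
  bc : b ≠ c

/-! ### Arithmetic relations lifted pointwise to sequences. -/

section Lift

variable {A : Type u} {ι κ : Type}

/-- A family of words codes sequences of equal length whose entries satisfy `R` pointwise. -/
def Lift (a b : A) (R : (ι → ℕ) → Prop) (v : ι → List A) : Prop :=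
  ∃ (n : ℕ) (x : ι → ℕ → ℕ), (∀ t < n, R fun i => x i t) ∧ ∀ i, v i = enc a b n (x i)

/-- The pointwise lift of `R` to sequences is definable. -/
def LiftDefinable (a b : A) (R : (ι → ℕ) → Prop) : Prop :=
  Definable (Lift a b R)

variable [DecidableEq A]

theorem lift_enc_iff [Nonempty ι] {a b : A} (hab : a ≠ b) (R : (ι → ℕ) → Prop) (n : ℕ)
    (x : ι → ℕ → ℕ) :
    Lift a b R (fun i => enc a b n (x i)) ↔ ∀ t < n, R fun i => x i t := by
  constructor
  · rintro ⟨m, y, h, he⟩ t ht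
    obtain ⟨rfl, -⟩ := enc_inj hab (he (Classical.arbitrary ι))
    convert h t ht using 2 with i
    exact (enc_inj hab (he i)).2 t ht
  · exact fun h => ⟨n, x, h, fun _ => rfl⟩

theorem lift_true_iff {a b : A} (hab : a ≠ b) (i₀ : ι) (v : ι → List A) :
    Lift a b (fun _ => True) v ↔
      ∀ i, (∃ n f, v i = enc a b n f) ∧ (v i).count b = (v i₀).count b := by
  constructor
  · rintro ⟨n, x, -, h⟩ i
    exact ⟨⟨n, _, h i⟩, by rw [h, h, count_enc_sep hab, count_enc_sep hab]⟩
  · intro h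
    choose n x hx using fun i => (h i).1
    refine ⟨n i₀, x, fun _ _ => trivial, fun i => ?_⟩
    have := (h i).2
    rw [hx, hx, count_enc_sep hab, count_enc_sep hab] at this
    rw [hx, this]

end Lift

namespace LiftDefinable

variable {A : Type u} {ι κ : Type} {a b c : A}

theorem congr {R S : (ι → ℕ) → Prop} (h : LiftDefinable a b R) (H : ∀ x, S x ↔ R x) :
    LiftDefinable a b S := by
  obtain rfl : S = R := funext fun x => propext (H x)
  exact h

theorem exs [Finite κ] {P : (ι → ℕ) → (κ → ℕ) → Prop}
    (h : LiftDefinable a b fun x : ι ⊕ κ → ℕ => P (fun i => x (.inl i)) fun i => x (.inr i)) :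
    LiftDefinable a b fun x => ∃ y, P x y := by
  refine (Definable.exs (P := fun (v : ι → List A) (w : κ → List A) =>
    Lift a b (fun x : ι ⊕ κ → ℕ => P (fun i => x (.inl i)) fun i => x (.inr i))
      (Sum.elim v w)) ?_).congr fun v => ?_
  · refine Definable.congr h fun v => ?_
    rw [show Sum.elim (fun i => v (.inl i)) (fun i => v (.inr i)) = v from Sum.elim_comp_inl_inr v]
  · constructor
    · rintro ⟨n, x, h, hv⟩
      choose! y hy using h
      exact ⟨fun k => enc a b n fun t => y t k, n, Sum.elim x fun k t => y t k, hy,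
        Sum.rec hv fun _ => rfl⟩
    · rintro ⟨w, n, x, h, hv⟩
      exact ⟨n, fun i => x (.inl i), fun t ht => ⟨_, h t ht⟩, fun i => hv (.inl i)⟩

variable [DecidableEq A] [Finite A] [Nontrivial A] [Finite ι]

theorem true (hd : Distinct a b c) (i₀ : ι) :
    LiftDefinable a b fun _ : ι → ℕ => True :=
  (Definable.all fun _ => (Definable.enc hd.ac hd.bc _).and (Definable.countEq _ _ _)).congr fun v =>
    lift_true_iff hd.ab i₀ v

theorem of_definable [Nonempty ι] (hd : Distinct a b c)
    {R : (ι → ℕ) → Prop} {Q : (ι → List A) → Prop} (hQ : Definable Q)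
    (h : ∀ n (x : ι → ℕ → ℕ), Q (fun i => enc a b n (x i)) ↔ ∀ t < n, R fun i => x i t) :
    LiftDefinable a b R := by
  refine ((true hd (Classical.arbitrary ι)).and hQ).congr fun v => ?_
  constructor
  · rintro ⟨n, x, hR, hv⟩
    obtain rfl : v = fun i => enc a b n (x i) := funext hv
    exact ⟨⟨n, x, fun _ _ => trivial, hv⟩, (h n x).2 hR⟩
  · rintro ⟨⟨n, x, -, hv⟩, hq⟩
    obtain rfl : v = fun i => enc a b n (x i) := funext hv
    exact ⟨n, x, (h n x).1 hq, hv⟩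

theorem and [Nonempty ι] (hd : Distinct a b c) {R S : (ι → ℕ) → Prop}
    (hR : LiftDefinable a b R) (hS : LiftDefinable a b S) :
    LiftDefinable a b fun x => R x ∧ S x :=
  of_definable hd (Definable.and hR hS) fun n x => by
    rw [lift_enc_iff hd.ab, lift_enc_iff hd.ab]
    exact ⟨fun h t ht => ⟨h.1 t ht, h.2 t ht⟩,
      fun h => ⟨fun t ht => (h t ht).1, fun t ht => (h t ht).2⟩⟩

theorem all [Nonempty ι] (hd : Distinct a b c) {β : Type} [Finite β]
    {R : β → (ι → ℕ) → Prop} (hR : ∀ k, LiftDefinable a b (R k)) :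
    LiftDefinable a b fun x => ∀ k, R k x :=
  of_definable hd (Definable.all hR) fun n x => by
    simp only [lift_enc_iff hd.ab]
    exact ⟨fun h t ht k => h k t ht, fun h k t ht => h t ht k⟩

theorem subst (hd : Distinct a b c) [Nonempty κ] {R : (κ → ℕ) → Prop}
    (hR : LiftDefinable a b R) (f : κ → ι) :
    LiftDefinable a b fun x : ι → ℕ => R fun k => x (f k) :=
  have : Nonempty ι := .map f inferInstance
  of_definable hd (Definable.subst hR f) fun n x => lift_enc_iff hd.ab R n fun k => x (f k)

theorem ex (hd : Distinct a b c) {P : (ι → ℕ) → ℕ → Prop}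
    (h : LiftDefinable a b fun x : Option ι → ℕ => P (fun i => x (some i)) (x none)) :
    LiftDefinable a b fun x => ∃ y, P x y := by
  have := subst hd h (ι := ι ⊕ Unit) (fun o => o.elim (.inr ()) .inl)
  refine (exs (P := fun v (w : Unit → ℕ) => P v (w ())) this).congr fun v => ?_
  exact ⟨fun ⟨x, h⟩ => ⟨fun _ => x, h⟩, fun ⟨w, h⟩ => ⟨w (), h⟩⟩

theorem eq (hd : Distinct a b c) (i j : ι) : LiftDefinable a b fun x : ι → ℕ => x i = x j :=
  have : Nonempty ι := ⟨i⟩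
  of_definable hd (Definable.eq i j) fun n x => by
    exact ⟨fun h => (enc_inj hd.ab h).2, fun h => enc_congr h⟩

theorem const (hd : Distinct a b c) (m : ℕ) (i : ι) :
    LiftDefinable a b fun x : ι → ℕ => x i = m :=
  have : Nonempty ι := ⟨i⟩
  of_definable hd (Definable.encConst hd.ab hd.ac hd.bc m i) fun n _ =>
    ⟨fun ⟨_, h⟩ => (enc_inj hd.ab h).2, fun h => ⟨n, enc_congr h⟩⟩

theorem add (hd : Distinct a b c) (k i j : ι) :
    LiftDefinable a b fun x : ι → ℕ => x k = x i + x j :=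
  have : Nonempty ι := ⟨i⟩
  of_definable hd (Definable.encAdd hd.ab hd.ac hd.bc i j k) fun n x => by
    constructor
    · rintro ⟨m, f, g, h₁, h₂, h₃⟩ t ht
      obtain ⟨rfl, hf⟩ := enc_inj hd.ab h₁
      beta_reduce
      rw [hf t ht, (enc_inj hd.ab h₂).2 t ht, (enc_inj hd.ab h₃).2 t ht]
    · exact fun h => ⟨n, _, _, rfl, rfl, enc_congr h⟩

theorem disjoint (hd : Distinct a b c) (i j : ι) :
    LiftDefinable a b fun x : ι → ℕ => x i = 0 ∨ x j = 0 :=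
  have : Nonempty ι := ⟨i⟩
  of_definable hd (Definable.encDisjoint hd.ab hd.ac hd.bc i j) fun n x => by
    constructor
    · rintro ⟨m, f, g, h₁, h₂, h₃⟩ t ht
      obtain ⟨rfl, hf⟩ := enc_inj hd.ab h₁
      beta_reduce
      rw [hf t ht, (enc_inj hd.ab h₂).2 t ht]
      exact h₃ t ht
    · exact fun h => ⟨n, _, _, rfl, rfl, h⟩

theorem addEq (hd : Distinct a b c) (i j k l : ι) :
    LiftDefinable a b fun x : ι → ℕ => x i + x j = x k + x l :=
  (ex hd (P := fun x y => y = x i + x j ∧ y = x k + x l) <|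
    and hd (add hd _ _ _) (add hd _ _ _)).congr fun x => by simp

theorem le (hd : Distinct a b c) (i j : ι) : LiftDefinable a b fun x : ι → ℕ => x i ≤ x j :=
  (ex hd (P := fun x y => x j = x i + y) <| add hd _ _ _).congr fun _ => le_iff_exists_add

theorem succ (hd : Distinct a b c) (i j : ι) :
    LiftDefinable a b fun x : ι → ℕ => x i = x j + 1 :=
  (ex hd (P := fun x y => y = 1 ∧ x i = x j + y) <| and hd (const hd _ _) (add hd _ _ _)).congr
    fun _ => by simp

/-- Lifts do not commute with disjunction, since different positions may need different cases. The
case distinction is therefore made by correction terms `y`, `z` that must vanish wherever `x i` does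
not. -/
theorem eqOfNeZero (hd : Distinct a b c) (i j k : ι) :
    LiftDefinable a b fun x : ι → ℕ => x i ≠ 0 → x j = x k := by
  have : Nonempty ι := ⟨i⟩
  refine (ex hd (P := fun x y => ∃ z, x j + y = x k + z ∧ (x i = 0 ∨ y = 0) ∧ (x i = 0 ∨ z = 0)) <|
    ex hd <| and hd (addEq hd _ _ _ _) <| and hd (disjoint hd _ _) (disjoint hd _ _)).congr
    fun x => ?_
  constructor
  · intro h
    by_cases h0 : x i = 0
    · exact ⟨x k, x j, by omega, .inl h0, .inl h0⟩
    · exact ⟨0, 0, by simpa using h h0, .inr rfl, .inr rfl⟩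
  · rintro ⟨y, z, h⟩
    omega

/-- Here `d` is the truncated difference `x j - x i`, nonzero exactly when `x i < x j`. The number
`k` is nonzero exactly when `d = 0`, so `d` and `k` are guards for the two branches. -/
theorem ite (hd : Distinct a b c) (r i j p q : ι) :
    LiftDefinable a b fun x : ι → ℕ => x r = if x i < x j then x p else x q := by
  have : Nonempty ι := ⟨i⟩
  refine (ex hd (P := fun x d => ∃ e, x i + d = x j + e ∧ (d = 0 ∨ e = 0) ∧
    (d ≠ 0 → x r = x p) ∧ ∃ k, (∃ o, o = 1 ∧ ∃ s, d + k = o + s) ∧ (d = 0 ∨ k = 0) ∧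
      (k ≠ 0 → x r = x q)) <|
    ex hd <| and hd (addEq hd _ _ _ _) <| and hd (disjoint hd _ _) <| and hd (eqOfNeZero hd _ _ _) <|
    ex hd <| and hd (ex hd <| and hd (const hd _ _) <| ex hd (addEq hd _ _ _ _)) <|
    and hd (disjoint hd _ _) (eqOfNeZero hd _ _ _)).congr fun x => ?_
  constructor
  · intro h
    by_cases hlt : x i < x j
    · rw [if_pos hlt] at h
      exact ⟨x j - x i, 0, by omega, by omega, fun _ => h, 0,
        ⟨1, rfl, x j - x i - 1, by omega⟩, .inr rfl, by simp⟩
    · rw [if_neg hlt] at h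
      exact ⟨0, x i - x j, by omega, by omega, by simp, 1, ⟨1, rfl, 0, rfl⟩, .inl rfl, fun _ => h⟩
  · rintro ⟨d, e, h₁, h₂, h₃, k, ⟨_, rfl, s, h₄⟩, h₅, h₆⟩
    split_ifs with h
    · exact h₃ (by omega)
    · exact h₆ (by omega)

end LiftDefinable

/-! ### Parallel runs of a step relation, and closure under primitive recursion. -/

section Runs

variable {A : Type u} {ι σ : Type} {a b c : A}

/-- The pairs of families of words that code `n` runs of the same length `T` of the step
relation `R`, executed in parallel: the first component codes the initial states and the second one
the final states. -/
def Runs (a b : A) (R : (σ ⊕ σ → ℕ) → Prop) (v : σ ⊕ σ → List A) : Prop :=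
  ∃ (n T : ℕ) (s : ℕ → ℕ → σ → ℕ),
    (∀ t < T, ∀ j < n, R (Sum.elim (s t j) (s (t + 1) j))) ∧
    (∀ i, v (.inl i) = enc a b n fun j => s 0 j i) ∧ ∀ i, v (.inr i) = enc a b n fun j => s T j i

/-- The graph of `f` lifts to definable relations between sequences. -/
def FunDefinable (a b : A) {n : ℕ} (f : List.Vector ℕ n → ℕ) : Prop :=
  ∀ {ι : Type} [Finite ι] (s : Fin n → ι) (r : ι),
    LiftDefinable a b fun x : ι → ℕ => x r = f (List.Vector.ofFn fun i => x (s i))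

variable [DecidableEq A]

/-- The states are listed time by time: position `t * n + j` belongs to run `j` at time `t`. The two
halves of `w` list times `0, …, T - 1` and `1, …, T`; preceding the second by the initial states, or
following the first by the final ones, gives the same list. Divisibility by `n` makes the number of
steps whole. -/
theorem runs_iff [Nonempty σ] (hd : Distinct a b c) (R : (σ ⊕ σ → ℕ) → Prop)
    (v : σ ⊕ σ → List A) :
    Runs a b R v ↔ Lift a b (fun _ => True) v ∧ ∃ w : σ ⊕ σ → List A, Lift a b R w ∧ ∀ i,
      (∃ W, (c ∉ v (.inl i) ∧ c ∉ w (.inr i) ∧ W = v (.inl i) ++ w (.inr i)) ∧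
        (c ∉ w (.inl i) ∧ c ∉ v (.inr i) ∧ W = w (.inl i) ++ v (.inr i))) ∧
      (v (.inl i)).count b ∣ (w (.inl i)).count b := by
  have hc : ∀ n f, c ∉ enc a b n f := fun n f h => by
    rcases mem_enc h with h | h
    · exact hd.ac h.symm
    · exact hd.bc h.symm
  constructor
  · rintro ⟨n, T, s, hR, hl, hr⟩
    refine ⟨⟨n, Sum.elim (fun i j => s 0 j i) (fun i j => s T j i), fun _ _ => trivial,
      Sum.rec hl hr⟩, ?_⟩
    refine ⟨Sum.elim (fun i => enc a b (n * T) fun k => s (k / n) (k % n) i)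
      (fun i => enc a b (n * T) fun k => s (k / n + 1) (k % n) i), ⟨n * T,
      Sum.elim (fun i k => s (k / n) (k % n) i) (fun i k => s (k / n + 1) (k % n) i),
      fun k hk => ?_, Sum.rec (fun _ => rfl) fun _ => rfl⟩, fun i => ⟨⟨_, ⟨?_, ?_, rfl⟩, ?_, ?_, ?_⟩, ?_⟩⟩
    · have hn : 0 < n := Nat.pos_of_ne_zero fun h => by simp [h] at hk
      convert hR (k / n) (Nat.div_lt_of_lt_mul hk) (k % n) (Nat.mod_lt _ hn) using 1
      ext (_ | _) <;> rfl
    · rw [hl]; exact hc _ _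
    · exact hc _ _
    · exact hc _ _
    · rw [hr]; exact hc _ _
    · rw [hl, hr]
      simp only [Sum.elim_inl, Sum.elim_inr]
      rcases Nat.eq_zero_or_pos n with rfl | hn
      · simp [enc]
      have h₁ := enc_add (x := a) (z := b) (m := n) (n := n * T) fun k => s (k / n) (k % n) i
      have h₂ := enc_add (x := a) (z := b) (m := n * T) (n := n) fun k => s (k / n) (k % n) i
      have e₁ : enc a b n (fun j => s 0 j i) = enc a b n fun k => s (k / n) (k % n) i :=
        enc_congr fun t ht => by rw [Nat.div_eq_of_lt ht, Nat.mod_eq_of_lt ht]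
      have e₂ : enc a b n (fun j => s T j i) =
          enc a b n fun k => s ((n * T + k) / n) ((n * T + k) % n) i :=
        enc_congr fun t ht => by
          rw [Nat.mul_add_div hn, Nat.mul_add_mod, Nat.div_eq_of_lt ht, Nat.mod_eq_of_lt ht,
            add_zero]
      have e₃ : (fun k => s (k / n + 1) (k % n) i) = fun k => s ((n + k) / n) ((n + k) % n) i := by
        funext k
        rw [Nat.add_div_left _ hn, Nat.add_mod_left]
      rw [e₁, e₂, e₃, ← h₁, ← h₂, add_comm]
    · rw [hl, Sum.elim_inl, count_enc_sep hd.ab, count_enc_sep hd.ab]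
      exact Dvd.intro _ rfl
  · rintro ⟨⟨n, x, -, hx⟩, w, ⟨M, y, hR, hy⟩, h⟩
    have hM : n ∣ M := by
      have := (h (Classical.arbitrary σ)).2
      rwa [hx, hy, count_enc_sep hd.ab, count_enc_sep hd.ab] at this
    obtain ⟨T, rfl⟩ := hM
    rcases Nat.eq_zero_or_pos n with rfl | hn
    · refine ⟨0, 0, fun _ _ _ => 0, by simp, fun i => ?_, fun i => ?_⟩ <;> rw [hx] <;> rfl
    have key : ∀ i, enc a b (n + n * T) (fun k => if k < n then x (.inl i) k else y (.inr i) (k - n))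
        = enc a b (n * T + n) fun k =>
          if k < n * T then y (.inl i) k else x (.inr i) (k - n * T) := fun i => by
      obtain ⟨W, ⟨-, -, h₁⟩, -, -, h₂⟩ := (h i).1
      rw [h₁, hx, hx, hy, hy] at h₂
      rw [enc_add, enc_add]
      convert h₂ using 2
      · exact enc_congr fun t ht => by rw [if_pos ht]
      · exact enc_congr fun t ht => by rw [if_neg (by omega)]; congr 1; omega
      · exact enc_congr fun t ht => by rw [if_pos ht]
      · exact enc_congr fun t ht => by rw [if_neg (by omega)]; congr 1; omega
    have key' := fun i => (enc_inj hd.ab (key i)).2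
    -- The state of run `j` at time `t` is entry `t * n + j` of the initial states followed by the
    -- successor states.
    refine ⟨n, T, fun t j i => if t * n + j < n then x (.inl i) (t * n + j) else
      y (.inr i) (t * n + j - n), fun t ht j hj => ?_, fun i => ?_, fun i => ?_⟩
    · have hlt : t * n + j < n * T := by nlinarith
      convert hR _ hlt using 1
      funext k
      rcases k with i | i
      · have := key' i (t * n + j) (by omega)
        rw [if_pos hlt] at this
        exact this
      · have e : (t + 1) * n + j = t * n + j + n := by ring
        simp only [Sum.elim_inr, e]
        rw [if_neg (by omega), Nat.add_sub_cancel]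
    · rw [hx]
      exact enc_congr fun t ht => by simp [ht]
    · rw [hx]
      refine enc_congr fun t ht => ?_
      have := key' i (n * T + t) (by omega)
      rw [if_neg (show ¬ n * T + t < n * T by omega), Nat.add_sub_cancel_left] at this
      rw [← this, mul_comm]

variable [Finite A] [Nontrivial A]

/-- The powers of `b^N a` contain exactly the multiples of `N` as numbers of `b`. -/
theorem Definable.countDvd (hd : Distinct a b c) (i j : ι) :
    Definable fun v : ι → List A => (v i).count b ∣ (v j).count b := by
  refine (ex (P := fun v p => (∃ N, p = replicate N b ++ a :: replicate 0 b) ∧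
    p.count b = (v i).count b ∧ ∃ P, (c ∉ p ∧ c ∉ P ∧ p ++ P = P ++ p) ∧
      P.count b = (v j).count b) <|
    (replicateAppend hd.ab.symm _ _).and <| (countEq _ _ _).and <| ex <|
    (commute _ _ _).and (countEq _ _ _)).congr fun v => ?_
  have hcount : ∀ N, (replicate N b ++ [a]).count b = N := fun N => by
    simp [count_append, hd.ab]
  constructor
  · rintro ⟨n, hn⟩
    refine ⟨_, ⟨(v i).count b, rfl⟩, hcount _, Subword.enc b a n fun _ => (v i).count b,
      ⟨?_, fun h => ?_, concat_const_commute _ _⟩, ?_⟩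
    · simp [hd.ac.symm, hd.bc.symm]
    · rcases mem_enc h with h | h
      · exact hd.bc h.symm
      · exact hd.ac h.symm
    · rw [count_enc hd.ab.symm, hn]
      simp [mul_comm]
  · rintro ⟨_, ⟨N, rfl⟩, h₁, P, ⟨-, -, h₂⟩, h₃⟩
    obtain ⟨n, rfl⟩ := exists_eq_concat_of_commute_replicate hd.ab.symm h₂
    have h₁ : N = _ := (hcount N).symm.trans h₁
    rw [count_enc hd.ab.symm] at h₃
    rw [← h₃, ← h₁]
    simp

theorem Definable.runs [Finite σ] [Nonempty σ] (hd : Distinct a b c) {R : (σ ⊕ σ → ℕ) → Prop}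
    (hR : LiftDefinable a b R) : Definable (Runs a b R) :=
  (and (LiftDefinable.true hd (.inl (Classical.arbitrary σ))) <| exs <|
    (Definable.subst hR Sum.inr).and <| all fun _ => (ex <| (append _ _ _ _).and (append _ _ _ _)).and
      (countDvd hd _ _)).congr fun v => runs_iff hd R v

namespace FunDefinable

theorem comp (hd : Distinct a b c) {m n : ℕ} {f : List.Vector ℕ n → ℕ}
    {g : Fin n → List.Vector ℕ m → ℕ} (hf : FunDefinable a b f)
    (hg : ∀ i, FunDefinable a b (g i)) :
    FunDefinable a b fun v => f (List.Vector.ofFn fun i => g i v) := fun {ι} _ s r => by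
  have : Nonempty ι := ⟨r⟩
  refine (LiftDefinable.exs (P := fun x (y : Fin n → ℕ) =>
    (∀ i, y i = g i (List.Vector.ofFn fun i => x (s i))) ∧ x r = f (List.Vector.ofFn y)) <|
    LiftDefinable.and hd (LiftDefinable.all hd fun i => hg i (fun j => Sum.inl (s j)) (Sum.inr i)) <|
    hf (fun i => Sum.inr i) (Sum.inl r)).congr fun x => ?_
  constructor
  · exact fun h => ⟨_, fun i => rfl, h⟩
  · rintro ⟨y, h, h'⟩
    rw [h', funext h]

/-- The step relation of a primitive recursion: the parameters and the bound `m` are kept, the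
counter `y` grows, and the value `h` is updated as long as `y < m`. -/
def PrecStep {n : ℕ} (g : List.Vector ℕ (n + 2) → ℕ)
    (z : (Fin n ⊕ Fin 3) ⊕ (Fin n ⊕ Fin 3) → ℕ) : Prop :=
  (∀ i, z (.inr (.inl i)) = z (.inl (.inl i))) ∧ z (.inr (.inr 0)) = z (.inl (.inr 0)) ∧
  z (.inr (.inr 1)) = z (.inl (.inr 1)) + 1 ∧
  ∃ p, p = g (z (.inl (.inr 1)) ::ᵥ z (.inl (.inr 2)) ::ᵥ List.Vector.ofFn fun i =>
      z (.inl (.inl i))) ∧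
    z (.inr (.inr 2)) = if z (.inl (.inr 1)) < z (.inl (.inr 0)) then p else z (.inl (.inr 2))

theorem precStep (hd : Distinct a b c) {n : ℕ} {g : List.Vector ℕ (n + 2) → ℕ}
    (hg : FunDefinable a b g) : LiftDefinable a b (PrecStep g) :=
  LiftDefinable.and hd (LiftDefinable.all hd fun _ => LiftDefinable.eq hd _ _) <|
    LiftDefinable.and hd (LiftDefinable.eq hd _ _) <|
    LiftDefinable.and hd (LiftDefinable.succ hd _ _) <| LiftDefinable.ex hd <|
    LiftDefinable.and hd
      (hg (Fin.cons (some (Sum.inl (Sum.inr 1))) (Fin.cons (some (Sum.inl (Sum.inr 2)))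
        fun i => some (Sum.inl (Sum.inl i)))) none) (LiftDefinable.ite hd _ _ _ _ _)

/-- The initial state and the final state of a primitive recursion. -/
def PrecEnds {n : ℕ} (f : List.Vector ℕ n → ℕ) (s : Fin (n + 1) → ι) (r : ι)
    (z : ι ⊕ ((Fin n ⊕ Fin 3) ⊕ (Fin n ⊕ Fin 3)) → ℕ) : Prop :=
  (∀ i, z (.inr (.inl (.inl i))) = z (.inl (s i.succ))) ∧
  z (.inr (.inl (.inr 0))) = z (.inl (s 0)) ∧ z (.inr (.inl (.inr 1))) = 0 ∧
  z (.inr (.inl (.inr 2))) = f (List.Vector.ofFn fun i => z (.inl (s i.succ))) ∧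
  z (.inl r) = z (.inr (.inr (.inr 2))) ∧ z (.inl (s 0)) ≤ z (.inr (.inr (.inr 1)))

theorem precEnds [Finite ι] (hd : Distinct a b c) {n : ℕ} {f : List.Vector ℕ n → ℕ}
    (hf : FunDefinable a b f) (s : Fin (n + 1) → ι) (r : ι) :
    LiftDefinable a b (PrecEnds f s r) :=
  LiftDefinable.and hd (LiftDefinable.all hd fun _ => LiftDefinable.eq hd _ _) <|
    LiftDefinable.and hd (LiftDefinable.eq hd _ _) <|
    LiftDefinable.and hd (LiftDefinable.const hd _ _) <|
    LiftDefinable.and hd (hf (fun i => Sum.inl (s i.succ)) _) <|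
    LiftDefinable.and hd (LiftDefinable.eq hd _ _) (LiftDefinable.le hd _ _)

theorem prec (hd : Distinct a b c) {n : ℕ} {f : List.Vector ℕ n → ℕ}
    {g : List.Vector ℕ (n + 2) → ℕ} (hf : FunDefinable a b f) (hg : FunDefinable a b g) :
    FunDefinable a b fun v : List.Vector ℕ (n + 1) =>
      v.head.rec (f v.tail) fun y IH => g (y ::ᵥ IH ::ᵥ v.tail) := fun {ι} _ s r => by
  have : Nonempty ι := ⟨r⟩
  let val (x : ι → ℕ) (k : ℕ) : ℕ :=
    k.rec (f (List.Vector.ofFn fun i => x (s i.succ)))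
      fun y IH => g (y ::ᵥ IH ::ᵥ List.Vector.ofFn fun i => x (s i.succ))
  have hval : ∀ x : ι → ℕ, (List.Vector.ofFn fun i => x (s i)).head.rec
      (f (List.Vector.ofFn fun i => x (s i)).tail)
      (fun y IH => g (y ::ᵥ IH ::ᵥ (List.Vector.ofFn fun i => x (s i)).tail)) =
      val x (x (s 0)) := fun x => by
    rfl
  simp only [hval]
  refine (Definable.exs (P := fun v w => Runs a b (PrecStep g) w ∧
    Lift a b (PrecEnds f s r) (Sum.elim v w)) <|
    ((Definable.runs hd (precStep hd hg)).subst _).and ?_).congr fun v => ?_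
  · refine Definable.congr (precEnds hd hf s r) fun v => ?_
    rw [show Sum.elim (fun i => v (.inl i)) (fun i => v (.inr i)) = v from Sum.elim_comp_inl_inr v]
  constructor
  · rintro ⟨N, x, h, hv⟩
    -- All runs have the same number of steps, although the recursion depths differ; a run that has
    -- reached its depth keeps its value, hence the `min`.
    let q (t j : ℕ) : Fin n ⊕ Fin 3 → ℕ := Sum.elim (fun i => x (s i.succ) j)
      ![x (s 0) j, t, val (fun i => x i j) (min t (x (s 0) j))]
    -- The sum is at least every recursion depth.
    let T := ∑ j ∈ Finset.range N, x (s 0) j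
    refine ⟨Sum.elim (fun i => enc a b N fun j => q 0 j i) fun i => enc a b N fun j => q T j i,
      ⟨N, T, q, fun t ht j hj => ⟨fun i => rfl, rfl, rfl, _, rfl, ?_⟩, fun _ => rfl, fun _ => rfl⟩,
      N, Sum.elim x (Sum.elim (fun i j => q 0 j i) fun i j => q T j i),
      fun j hj => ⟨fun i => rfl, rfl, rfl, ?_, ?_, ?_⟩,
      Sum.rec hv (Sum.rec (fun _ => rfl) fun _ => rfl)⟩
    · change val (fun i => x i j) (min (t + 1) (x (s 0) j)) = if t < x (s 0) j then
        g (t ::ᵥ val (fun i => x i j) (min t (x (s 0) j)) ::ᵥ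
          List.Vector.ofFn fun i => x (s i.succ) j) else val (fun i => x i j) (min t (x (s 0) j))
      split_ifs with hlt
      · rw [min_eq_left (by omega), min_eq_left (by omega)]
      · rw [min_eq_right (by omega), min_eq_right (by omega)]
    · change val (fun i => x i j) (min 0 (x (s 0) j)) = _
      rw [Nat.zero_min]
      rfl
    · change x r j = val (fun i => x i j) (min T (x (s 0) j))
      rw [min_eq_right]
      · exact h j hj
      · exact Finset.single_le_sum (f := x (s 0)) (fun _ _ => Nat.zero_le _) (Finset.mem_range.2 hj)
    · exact Finset.single_le_sum (f := x (s 0)) (fun _ _ => Nat.zero_le _) (Finset.mem_range.2 hj)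
  · rintro ⟨w, ⟨n', T, q, hq, hl, hr⟩, N, x, hx, hv⟩
    obtain rfl : N = n' :=
      (enc_inj hd.ab ((hv (.inr (.inl (.inr 0)))).symm.trans (hl (.inr 0)))).1
    refine ⟨N, fun i => x (.inl i), fun j hj => ?_, fun i => hv (.inl i)⟩
    have el : ∀ i, x (.inr (.inl i)) j = q 0 j i := fun i =>
      (enc_inj hd.ab ((hv (.inr (.inl i))).symm.trans (hl i))).2 j hj
    have er : ∀ i, x (.inr (.inr i)) j = q T j i := fun i =>
      (enc_inj hd.ab ((hv (.inr (.inr i))).symm.trans (hr i))).2 j hj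
    obtain ⟨h₁, h₂, h₃, h₄, h₅, h₆⟩ := hx j hj
    simp only [el, er] at h₁ h₂ h₃ h₄ h₅ h₆
    -- At time `T` the counter is `T`, and the end condition makes it at least the recursion depth,
    -- so the `min` is the depth itself.
    have inv : ∀ t ≤ T, (∀ i, q t j (.inl i) = x (.inl (s i.succ)) j) ∧
        q t j (.inr 0) = x (.inl (s 0)) j ∧ q t j (.inr 1) = t ∧
        q t j (.inr 2) = val (fun i => x (.inl i) j) (min t (x (.inl (s 0)) j)) := by
      intro t
      induction t with
      | zero =>
        intro _
        refine ⟨h₁, h₂, h₃, ?_⟩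
        rw [Nat.zero_min]
        exact h₄
      | succ t ih =>
        intro ht
        obtain ⟨i₁, i₂, i₃, i₄⟩ := ih (by omega)
        obtain ⟨k₁, k₂, k₃, p, k₄, k₅⟩ := hq t (by omega) j hj
        simp only [Sum.elim_inl, Sum.elim_inr] at k₁ k₂ k₃ k₄ k₅
        refine ⟨fun i => (k₁ i).trans (i₁ i), k₂.trans i₂, by rw [k₃, i₃], ?_⟩
        rw [k₅, k₄]
        simp only [i₁, i₂, i₃, i₄]
        split_ifs with hlt
        · rw [min_eq_left (by omega), min_eq_left (by omega)]
        · rw [min_eq_right (by omega), min_eq_right (by omega)]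
    obtain ⟨-, -, e₁, e₂⟩ := inv T le_rfl
    rw [e₁] at h₆
    rw [min_eq_right h₆] at e₂
    exact h₅.trans e₂

theorem of_primrec' (hd : Distinct a b c) {n : ℕ} {f : List.Vector ℕ n → ℕ}
    (hf : Nat.Primrec' f) : FunDefinable a b f := by
  induction hf with
  | zero => exact fun s r => LiftDefinable.const hd 0 r
  | succ => exact fun s r => LiftDefinable.succ hd r (s 0)
  | get i =>
    exact fun s r => (LiftDefinable.eq hd r (s i)).congr fun x => by simp
  | comp g _ _ ihf ihg => exact comp hd ihf ihg
  | prec _ _ ihf ihg => exact prec hd ihf ihg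

end FunDefinable

end Runs

/-! ### Numerical codes of two-letter projections. -/

section Code

variable {A : Type u}

/-- The word that represents a natural number. -/
def num (a b : A) (m : ℕ) : List A := replicate m a ++ b :: replicate 0 a

theorem enc_one (a b : A) (f : ℕ → ℕ) : enc a b 1 f = num a b (f 0) := by
  simp [enc, num, concat_succ]

variable [DecidableEq A]

/-- One step of the computation of `code`: the state consists of the code of the blocks read so far
and of the length of the current block of letters `a`. -/
def codeStep (a b : A) (q : ℕ × ℕ) (t : A) : ℕ × ℕ :=
  if t = a then (q.1, q.2 + 1) else if t = b then (Nat.pair q.1 q.2 + 1, 0) else q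

/-- A numerical code of the projection of a word to the letters `a` and `b`. -/
def code (a b : A) (w : List A) : ℕ :=
  ((w ++ [b]).foldl (codeStep a b) (0, 0)).1

/-- The code of a finite sequence of natural numbers. -/
def seqCode (f : ℕ → ℕ) : ℕ → ℕ
  | 0 => 0
  | n + 1 => Nat.pair (seqCode f n) (f n) + 1

theorem seqCode_inj {f g : ℕ → ℕ} {n m : ℕ} (h : seqCode f n = seqCode g m) :
    n = m ∧ ∀ t < n, f t = g t := by
  induction n generalizing m with
  | zero => cases m <;> simp_all [seqCode]
  | succ n ih =>
    rcases m with _ | m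
    · simp [seqCode] at h
    · obtain ⟨h₁, h₂⟩ := Nat.pair_eq_pair.1 (Nat.succ_injective h)
      obtain ⟨rfl, h₃⟩ := ih h₁
      refine ⟨rfl, fun t ht => ?_⟩
      rcases Nat.lt_succ_iff_lt_or_eq.1 ht with ht | rfl
      · exact h₃ t ht
      · exact h₂

theorem foldl_codeStep_replicate (a b : A) (q : ℕ × ℕ) (n : ℕ) :
    (replicate n a).foldl (codeStep a b) q = (q.1, q.2 + n) := by
  induction n generalizing q with
  | zero => rfl
  | succ n ih =>
    rw [replicate_succ, foldl_cons, ih]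
    simp [codeStep, add_assoc, add_comm 1]

theorem foldl_codeStep_enc {a b : A} (hab : a ≠ b) (n : ℕ) (f : ℕ → ℕ) :
    (enc a b n f).foldl (codeStep a b) (0, 0) = (seqCode f n, 0) := by
  induction n with
  | zero => rfl
  | succ n ih =>
    rw [enc, concat_succ, ← enc, foldl_append, ih, foldl_append, foldl_codeStep_replicate]
    simp [codeStep, hab.symm, seqCode]

theorem foldl_codeStep_filter (a b : A) (q : ℕ × ℕ) (w : List A) :
    (w.filter (onPair a b)).foldl (codeStep a b) q = w.foldl (codeStep a b) q := by
  induction w generalizing q with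
  | nil => rfl
  | cons t w ih =>
    by_cases h : t = a ∨ t = b
    · rw [filter_cons_of_pos (by simpa [onPair] using h), foldl_cons, foldl_cons, ih]
    · rw [filter_cons_of_neg (by simpa [onPair] using h), foldl_cons, ih]
      push Not at h
      simp [codeStep, h]

theorem exists_enc_filter (a b : A) (w : List A) :
    ∃ n f, w.filter (onPair a b) ++ [b] = enc a b (n + 1) f :=
  exists_append_eq_enc fun y hy => by simpa [onPair] using (mem_filter.1 hy).2

theorem code_eq {a b : A} (hab : a ≠ b) {w : List A} {n : ℕ} {f : ℕ → ℕ}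
    (h : w.filter (onPair a b) ++ [b] = enc a b n f) : code a b w = seqCode f n := by
  rw [code, foldl_append, ← foldl_codeStep_filter a b _ w, ← foldl_append, h,
    foldl_codeStep_enc hab]

theorem filter_eq_of_code_eq {a b : A} (hab : a ≠ b) {u v : List A}
    (h : code a b u = code a b v) : u.filter (onPair a b) = v.filter (onPair a b) := by
  obtain ⟨n, f, hu⟩ := exists_enc_filter a b u
  obtain ⟨m, g, hv⟩ := exists_enc_filter a b v
  rw [code_eq hab hu, code_eq hab hv] at h
  obtain ⟨hn, hf⟩ := seqCode_inj h
  rw [← hn, ← enc_congr hf, ← hu] at hv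
  exact (append_cancel_right hv).symm

theorem count_num {a b : A} (hab : a ≠ b) (m : ℕ) : (num a b m).count a = m := by
  simp [num, count_append, hab.symm]

theorem num_inj {a b : A} (hab : a ≠ b) {m n : ℕ} (h : num a b m = num a b n) : m = n := by
  rw [← count_num hab m, h, count_num hab]

/-- The sequence `C` lists the codes of the proper initial segments of the block sequence `X`, and
`C'` the codes one step later, computed by lifted pairing. The equation `b C' = C K` is the shift:
`b` codes the initial `0`, and `K` holds the last code. -/
theorem eq_num_code_iff {a b c : A} (hd : Distinct a b c) (w K : List A) :
    K = num a b (code a b w) ↔ (∃ N, K = replicate N a ++ b :: replicate 0 a) ∧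
      ∃ u, u = w.filter (onPair a b) ∧ ∃ p, p = [b] ∧ ∃ X, (c ∉ u ∧ c ∉ p ∧ X = u ++ p) ∧
      ∃ C C', Lift a b (fun x : Fin 3 → ℕ => x 2 = Nat.pair (x 0) (x 1) + 1) ![C, X, C'] ∧
      ∃ W, (c ∉ p ∧ c ∉ C' ∧ W = p ++ C') ∧ (c ∉ C ∧ c ∉ K ∧ W = C ++ K) := by
  have hc : ∀ n f, c ∉ enc a b n f := fun n f h => by
    rcases mem_enc h with h | h
    · exact hd.ac h.symm
    · exact hd.bc h.symm
  obtain ⟨n, f, hf⟩ := exists_enc_filter a b w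
  rw [code_eq hd.ab hf]
  constructor
  · rintro rfl
    refine ⟨⟨_, rfl⟩, _, rfl, _, rfl, _, ⟨?_, ?_, rfl⟩, enc a b (n + 1) (seqCode f),
      enc a b (n + 1) fun t => seqCode f (t + 1),
      ⟨n + 1, ![seqCode f, f, fun t => seqCode f (t + 1)], fun t _ => rfl, fun i => ?_⟩, _,
      ⟨?_, hc _ _, rfl⟩, hc _ _, ?_, ?_⟩
    · simp [onPair, hd.ac.symm, hd.bc.symm]
    · simp [hd.bc.symm]
    · fin_cases i
      · rfl
      · exact hf
      · rfl
    · simp [hd.bc.symm]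
    · simp [num, hd.ac.symm, hd.bc.symm]
    · have h₁ := enc_add (x := a) (z := b) (m := 1) (n := n + 1) (seqCode f)
      have h₂ := enc_add (x := a) (z := b) (m := n + 1) (n := 1) (seqCode f)
      rw [enc_one] at h₁ h₂
      rw [add_comm 1, h₂] at h₁
      simpa [num, seqCode, add_comm 1] using h₁.symm
  · rintro ⟨⟨N, rfl⟩, _, rfl, _, rfl, _, ⟨-, -, rfl⟩, C, C', ⟨m, x, hR, hx⟩, _, ⟨-, -, rfl⟩, -, -, h⟩
    have e₁ : enc a b (n + 1) f = enc a b m (x 1) := hf.symm.trans (hx 1)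
    have e₀ : C = enc a b m (x 0) := hx 0
    have e₂ : C' = enc a b m (x 2) := hx 2
    obtain ⟨rfl, hfx⟩ := enc_inj hd.ab e₁
    have key : enc a b (1 + (n + 1)) (fun t => if t = 0 then 0 else x 2 (t - 1)) =
        enc a b (n + 1 + 1) fun t => if t < n + 1 then x 0 t else N := by
      have l₁ : (enc a b (n + 1) fun t => if 1 + t = 0 then 0 else x 2 (1 + t - 1)) = C' := by
        rw [e₂]
        refine enc_congr fun t _ => ?_
        rw [if_neg (by omega), Nat.add_sub_cancel_left]
      have l₂ : (enc a b (n + 1) fun t => if t < n + 1 then x 0 t else N) = C := by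
        rw [e₀]
        exact enc_congr fun t ht => by rw [if_pos ht]
      rw [enc_add, enc_add (m := n + 1), enc_one, enc_one, l₁, l₂, if_pos rfl, if_neg (by omega)]
      exact h
    have key' := (enc_inj hd.ab key).2
    have hval : ∀ t ≤ n, x 0 t = seqCode f t := by
      intro t
      induction t with
      | zero =>
        intro _
        exact (key' 0 (by omega)).symm
      | succ t ih =>
        intro ht
        have h₁ := key' (t + 1) (by omega)
        have h₂ : x 2 t = Nat.pair (x 0 t) (x 1 t) + 1 := hR t (by omega)
        rw [if_neg (by omega), if_pos (by omega), Nat.add_sub_cancel] at h₁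
        rw [← h₁, h₂, ih (by omega), ← hfx t (by omega)]
        rfl
    have h₁ := key' (n + 1) (by omega)
    have h₂ : x 2 n = Nat.pair (x 0 n) (x 1 n) + 1 := hR n (by omega)
    rw [if_neg (by omega), if_neg (by omega), Nat.add_sub_cancel] at h₁
    rw [← h₁, h₂, hval n le_rfl, ← hfx n (by omega)]
    rfl

end Code

/-! ### Definability of word codes and of primitive recursive functions on numbers. -/

namespace Definable

variable {A : Type u} [DecidableEq A] [Finite A] [Nontrivial A] {α : Type} {a b c : A}

theorem numCode (hd : Distinct a b c) (i j : α) :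
    Definable fun v : α → List A => v j = num a b (code a b (v i)) := by
  have hpair : LiftDefinable a b fun x : Fin 3 → ℕ => x 2 = Nat.pair (x 0) (x 1) + 1 :=
    FunDefinable.of_primrec' hd (f := fun v : List.Vector ℕ 2 => Nat.pair v.head v.tail.head + 1)
      (Nat.Primrec'.prim_iff₂.2 (Primrec.succ.comp₂ Primrec₂.natPair)) ![0, 1] 2
  have hlift : ∀ {β : Type} (p q r : β), Definable fun v : β → List A =>
      Lift a b (fun x : Fin 3 → ℕ => x 2 = Nat.pair (x 0) (x 1) + 1) ![v p, v q, v r] :=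
    fun p q r => (subst hpair ![p, q, r]).congr fun v => by
      rw [show ![v p, v q, v r] = fun i => v (![p, q, r] i) from
        funext fun i => by fin_cases i <;> rfl]
  exact ((replicateAppend hd.ab _ _).and <| ex <| (filter _ _ _).and <| ex <|
    (eq_const _ _).and <| ex <| (append _ _ _ _).and <| ex <| ex <| (hlift _ _ _).and <| ex <|
    (append _ _ _ _).and (append _ _ _ _)).congr fun _ => eq_num_code_iff hd _ _

/-- A number is a sequence of length one, where the lifted graph of `f` is the graph itself. -/
theorem numPrimrec (hd : Distinct a b c) {f : ℕ → ℕ} (hf : Primrec f) (i j : α) :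
    Definable fun v : α → List A => ∃ m, v i = num a b m ∧ v j = num a b (f m) := by
  have hlift : LiftDefinable a b fun x : Fin 2 → ℕ => x 1 = f (x 0) :=
    FunDefinable.of_primrec' hd (f := fun v : List.Vector ℕ 1 => f v.head)
      (Nat.Primrec'.prim_iff₁.2 hf) ![0] 1
  refine ((replicateAppend hd.ab 0 i).and (subst hlift ![i, j])).congr fun v => ?_
  constructor
  · rintro ⟨m, hi, hj⟩
    refine ⟨⟨m, hi⟩, 1, ![fun _ => m, fun _ => f m], fun t _ => rfl, fun k => ?_⟩
    fin_cases k
    · exact hi.trans (enc_one a b fun _ => m).symm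
    · exact hj.trans (enc_one a b fun _ => f m).symm
  · rintro ⟨⟨m, hi⟩, n, x, hR, hx⟩
    have h₀ : v i = Subword.enc a b n (x 0) := hx 0
    have h₁ : v j = Subword.enc a b n (x 1) := hx 1
    obtain rfl : n = 1 := by
      rw [← count_enc_sep hd.ab n (x 0), ← h₀, hi]
      simp [count_append, count_replicate, hd.ab]
    have h₂ : x 1 0 = f (x 0 0) := hR 0 one_pos
    rw [enc_one] at h₀ h₁
    exact ⟨_, h₀, by rw [h₁, h₂]⟩

/-- Comparison of the numbers of occurrences of two letters. -/
theorem countEqCount {x y z : A} (hd : Distinct x y z) (i j : α) :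
    Definable fun v : α → List A => (v i).count x = (v j).count y := by
  refine (ex (P := fun v p => p = replicate 1 x ++ [y] ∧ ∃ P, (z ∉ p ∧ z ∉ P ∧ p ++ P = P ++ p) ∧
    (v i).count x = P.count x ∧ (v j).count y = P.count y) <| (eq_const _ _).and <| ex <|
    (commute _ _ _).and <| (countEq _ _ _).and (countEq _ _ _)).congr fun v => ?_
  constructor
  · intro h
    refine ⟨_, rfl, Subword.enc x y ((v i).count x) fun _ => 1,
      ⟨by simp [hd.ac.symm, hd.bc.symm], fun h => ?_, concat_const_commute _ _⟩, ?_, ?_⟩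
    · rcases mem_enc h with h | h
      · exact hd.ac h.symm
      · exact hd.bc h.symm
    · rw [count_enc hd.ab]; simp
    · rw [count_enc_sep hd.ab, h]
  · rintro ⟨_, rfl, P, ⟨-, -, h⟩, h₁, h₂⟩
    obtain ⟨n, rfl⟩ := exists_eq_concat_of_commute_replicate hd.ab h
    rw [count_enc hd.ab] at h₁
    rw [count_enc_sep hd.ab] at h₂
    simp_all

end Definable

/-! ### Recursively enumerable predicates as projections of primitive recursive ones. -/

section Computability

variable {α β : Type*} [Primcodable α] [Primcodable β]

theorem exists_primrec_of_rePred {p : α → Prop} (h : REPred p) :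
    ∃ g : α → ℕ → Bool, Primrec₂ g ∧ ∀ x, p x ↔ ∃ n, g x n = true := by
  obtain ⟨c, hc⟩ := Nat.Partrec.Code.exists_code.1 h
  refine ⟨fun x n => (c.evaln n (Encodable.encode x)).isSome, ?_, fun x => ?_⟩
  · exact Primrec.option_isSome.comp (Nat.Partrec.Code.primrec_evaln.comp
      ((Primrec.snd.pair (Primrec.const c)).pair (Primrec.encode.comp Primrec.fst)))
  · have h₁ : p x ↔ (c.eval (Encodable.encode x)).Dom := by
      rw [hc]
      simp only [Encodable.encodek, Part.coe_some, Part.bind_some]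
      exact ⟨fun h => ⟨h, trivial⟩, fun ⟨h, _⟩ => h⟩
    rw [h₁, Part.dom_iff_mem]
    simp only [Nat.Partrec.Code.evaln_complete, Option.isSome_iff_exists, Option.mem_def]
    exact exists_comm

/-- The index `m` codes a candidate together with a bound on the computation; `none` marks a failed
check and also allows for an empty predicate. -/
theorem exists_primrec_enum_of_rePred {p : α → Prop} (h : REPred p) :
    ∃ e : ℕ → Option α, Primrec e ∧ ∀ x, p x ↔ ∃ m, e m = some x := by
  obtain ⟨g, hg, hp⟩ := exists_primrec_of_rePred h
  refine ⟨fun m => (Encodable.decode (α := α × ℕ) m).bind fun q =>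
    bif g q.1 q.2 then some q.1 else none, ?_, fun x => ?_⟩
  · refine Primrec.option_bind Primrec.decode ?_
    exact Primrec.cond (hg.comp (Primrec.fst.comp Primrec.snd) (Primrec.snd.comp Primrec.snd))
      (Primrec.option_some.comp (Primrec.fst.comp Primrec.snd)) (Primrec.const none)
  · rw [hp]
    constructor
    · rintro ⟨n, hn⟩
      refine ⟨Encodable.encode (x, n), ?_⟩
      simp only [Encodable.encodek, Option.bind_some, hn, cond_true]
    · rintro ⟨m, hm⟩
      obtain ⟨q, -, hq⟩ := Option.bind_eq_some_iff.1 hm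
      rcases hn : g q.1 q.2 with _ | _
      · rw [hn] at hq
        cases hq
      · rw [hn] at hq
        cases hq
        exact ⟨_, hn⟩

theorem rePred_of_primrec {g : α → ℕ → Bool} (hg : Primrec₂ g) :
    REPred fun x => ∃ n, g x n = true := by
  have : Partrec fun x => Nat.rfind fun n => (Part.some (g x n) : Part Bool) :=
    Partrec.rfind hg.to_comp.partrec₂
  refine this.dom_re.of_eq fun x => Nat.rfind_dom.trans (exists_congr fun n => ?_)
  exact ⟨fun h => (Part.mem_some_iff.1 h.1).symm, fun h =>
    ⟨Part.mem_some_iff.2 h.symm, fun _ => trivial⟩⟩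

theorem rePred_exists {p : α → β → Prop} (h : REPred fun q : α × β => p q.1 q.2) :
    REPred fun x => ∃ y, p x y := by
  obtain ⟨g, hg, hp⟩ := exists_primrec_of_rePred h
  let g' (x : α) (m : ℕ) : Bool :=
    ((Encodable.decode (α := β × ℕ) m).map fun q => g (x, q.1) q.2).getD false
  have hg' : Primrec₂ g' := by
    refine Primrec.option_getD.comp (Primrec.option_map (Primrec.decode.comp Primrec.snd) ?_)
      (Primrec.const _)
    exact hg.comp ((Primrec.fst.comp Primrec.fst).pair (Primrec.fst.comp Primrec.snd))
      (Primrec.snd.comp Primrec.snd)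
  refine (rePred_of_primrec hg').of_eq fun x => ?_
  constructor
  · rintro ⟨m, hm⟩
    rcases hd : Encodable.decode (α := β × ℕ) m with _ | q
    · simp only [g', hd, Option.map_none, Option.getD_none, Bool.false_eq_true] at hm
    · simp only [g', hd, Option.map_some, Option.getD_some] at hm
      exact ⟨q.1, (hp (x, q.1)).2 ⟨q.2, hm⟩⟩
  · rintro ⟨y, hy⟩
    obtain ⟨n, hn⟩ := (hp (x, y)).1 hy
    refine ⟨Encodable.encode (y, n), ?_⟩
    simpa only [g', Encodable.encodek, Option.map_some, Option.getD_some] using hn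

theorem rePred_comp {p : β → Prop} (hp : REPred p) {f : α → β} (hf : Primrec f) :
    REPred fun x => p (f x) :=
  Partrec.comp hp hf.to_comp

end Computability

/-! ### The subword relation is primitive recursive. -/

section Sublist

variable {A : Type u} [DecidableEq A]

/-- Delete the first letter of a word if it is `t`. -/
def dropLetter (r : List A) (t : A) : List A := if r.head? = some t then r.tail else r

/-- Greedy matching from the left finds an embedding whenever there is one. -/
theorem foldl_dropLetter_eq_nil_iff (l₁ l₂ : List A) :
    l₂.foldl dropLetter l₁ = [] ↔ l₁ <+ l₂ := by
  induction l₂ generalizing l₁ with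
  | nil => simp
  | cons t l₂ ih =>
    rw [foldl_cons, ih]
    rcases l₁ with _ | ⟨x, l₁⟩
    · simp [dropLetter]
    · by_cases h : x = t
      · subst h
        simp [dropLetter]
      · simp only [dropLetter, head?_cons, Option.some.injEq, h, if_false]
        exact ⟨fun h => h.cons _, fun h' => h'.of_cons_of_ne h⟩

theorem primrec_sublist [Primcodable A] :
    PrimrecRel fun l₁ l₂ : List A => l₁ <+ l₂ := by
  have hstep : Primrec₂ fun (_ : List A × List A) (q : List A × A) => dropLetter q.1 q.2 := by
    refine Primrec.ite ?_ (Primrec.list_tail.comp (Primrec.fst.comp Primrec.snd))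
      (Primrec.fst.comp Primrec.snd)
    exact Primrec.eq.comp (Primrec.list_head?.comp (Primrec.fst.comp Primrec.snd))
      (Primrec.option_some.comp (Primrec.snd.comp Primrec.snd))
  have := Primrec.eq.comp (Primrec.list_foldl Primrec.snd Primrec.fst hstep)
    (Primrec.const ([] : List A))
  exact this.of_eq fun q => foldl_dropLetter_eq_nil_iff q.1 q.2

end Sublist

/-! ### Definable relations are recursively enumerable. -/

section Formula

variable {A : Type u} [Primcodable A] {k n : ℕ}

theorem primrec_assignment (i : Fin k ⊕ Fin n) :
    Primrec fun q : (Fin k → List A) × (Fin n → List A) => Sum.elim q.1 q.2 i := by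
  rcases i with i | i
  · exact Primrec.fin_app.comp Primrec.fst (Primrec.const i)
  · exact Primrec.fin_app.comp Primrec.snd (Primrec.const i)

theorem primrec_realize_term (t : (subwordLanguage A).Term (Fin k ⊕ Fin n)) :
    Primrec fun q : (Fin k → List A) × (Fin n → List A) => t.realize (Sum.elim q.1 q.2) := by
  induction t with
  | var i => exact primrec_assignment i
  | @func l f ts _ =>
    rcases f with f | f
    · exact f.elim
    · rcases l with _ | l
      · exact Primrec.const (α := (Fin k → List A) × (Fin n → List A)) (show List A from f)
      · exact f.elim

theorem primrecPred_realize {φ : (subwordLanguage A).BoundedFormula (Fin k) n}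
    (h : φ.IsQF) :
    PrimrecPred fun q : (Fin k → List A) × (Fin n → List A) => φ.Realize q.1 q.2 := by
  classical
  induction h with
  | falsum => exact (PrimrecPred.of_eq (p := fun _ => False) ⟨inferInstance, Primrec.const _⟩ fun _ => Iff.rfl)
  | of_isAtomic h =>
    rcases h with ⟨t₁, t₂⟩ | ⟨R, ts⟩
    · exact (Primrec.eq.comp (primrec_realize_term t₁) (primrec_realize_term t₂)).of_eq fun _ =>
        Iff.rfl
    · rcases R with R | R
      · cases R
        exact (primrec_sublist.comp (primrec_realize_term (ts 0)) (primrec_realize_term (ts 1))).of_eq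
          fun _ => Iff.rfl
      · exact R.elim
  | imp _ _ h₁ h₂ =>
    refine (h₁.not.or h₂).of_eq fun q => ?_
    rw [Language.BoundedFormula.realize_imp]
    tauto

theorem rePred_realize {φ : (subwordLanguage A).BoundedFormula (Fin k) n}
    (h : φ.IsExistential) :
    REPred fun q : (Fin k → List A) × (Fin n → List A) => φ.Realize q.1 q.2 := by
  induction h with
  | of_isQF h => exact (primrecPred_realize h).computablePred.to_re
  | @ex n φ _ ih =>
    have : REPred fun q : ((Fin k → List A) × (Fin n → List A)) × List A =>
        φ.Realize q.1.1 (Fin.snoc q.1.2 q.2) := by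
      refine rePred_comp ih ((Primrec.fst.comp Primrec.fst).pair
        (Primrec.fin_curry.2 (Primrec₂.swap (Primrec.fin_curry₁.2 fun i => ?_))))
      induction i using Fin.lastCases with
      | last => exact Primrec.snd.of_eq fun q => (Fin.snoc_last (α := fun _ => List A) q.2 q.1.2).symm
      | cast i =>
        exact (Primrec.fin_app.comp (Primrec.snd.comp Primrec.fst) (Primrec.const i)).of_eq fun q =>
          (Fin.snoc_castSucc (α := fun _ => List A) q.2 q.1.2 i).symm
    exact (rePred_exists this).of_eq fun q => Language.BoundedFormula.realize_ex.symm

theorem rePred_of_sigmaOneDefinable {R : Set (Fin k → List A)} (h : SigmaOneDefinable R) :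
    REPred fun v : Fin k → List A => v ∈ R := by
  obtain ⟨φ, hφ, hR⟩ := h
  exact (rePred_comp (rePred_realize hφ) (Primrec.id.pair (Primrec.const _))).of_eq
    fun v => (hR v).symm

end Formula

/-! ### Recursively enumerable relations are definable. -/

section Enumerable

variable {A : Type u} [DecidableEq A]

theorem exists_distinct [Fintype A] (hA : 3 ≤ Fintype.card A) {x y : A} (hxy : x ≠ y) :
    ∃ z, Distinct x y z := by
  obtain ⟨z, -, hz⟩ := Finset.exists_mem_notMem_of_card_lt_card
    (s := {x, y}) (t := (Finset.univ : Finset A))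
    (lt_of_le_of_lt Finset.card_le_two (by rw [Finset.card_univ]; omega))
  simp only [Finset.mem_insert, Finset.mem_singleton, not_or] at hz
  exact ⟨z, hxy, Ne.symm hz.1, Ne.symm hz.2⟩

theorem eq_of_code_eq [Nontrivial A] {u v : List A}
    (h : ∀ x y, x ≠ y → code x y u = code x y v) : u = v :=
  eq_of_filter_onPair (S := Set.univ)
    (fun y _ => (exists_ne y).imp fun _ hx => ⟨Set.mem_univ _, hx⟩)
    (fun _ _ => Set.mem_univ _) (fun _ _ => Set.mem_univ _)
    fun x _ y _ hxy => filter_eq_of_code_eq hxy (h x y hxy)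

variable [Primcodable A]

theorem primrec_code (x y : A) : Primrec (code x y) := by
  have hstep : Primrec₂ fun (_ : List A) (q : (ℕ × ℕ) × A) => codeStep x y q.1 q.2 := by
    have ht : Primrec fun q : List A × ((ℕ × ℕ) × A) => q.2.2 := Primrec.snd.comp Primrec.snd
    have h₁ : Primrec fun q : List A × ((ℕ × ℕ) × A) => q.2.1.1 :=
      Primrec.fst.comp (Primrec.fst.comp Primrec.snd)
    have h₂ : Primrec fun q : List A × ((ℕ × ℕ) × A) => q.2.1.2 :=
      Primrec.snd.comp (Primrec.fst.comp Primrec.snd)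
    exact Primrec.ite (Primrec.eq.comp ht (Primrec.const x)) (h₁.pair (Primrec.succ.comp h₂))
      (Primrec.ite (Primrec.eq.comp ht (Primrec.const y))
        ((Primrec.succ.comp (Primrec₂.natPair.comp h₁ h₂)).pair (Primrec.const 0))
        (Primrec.fst.comp Primrec.snd))
  exact Primrec.fst.comp (Primrec.list_foldl
    (Primrec.list_append.comp Primrec.id (Primrec.const [y])) (Primrec.const (0, 0)) hstep)

/-- A recursively enumerable relation is the projection of one that is given by primitive recursive
functions on the codes of words. -/
theorem exists_primrec_code [Nontrivial A] {k : ℕ} {R : Set (Fin k → List A)}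
    (h : REPred fun v : Fin k → List A => v ∈ R) :
    ∃ (G : ℕ → ℕ) (F : Fin k → A → A → ℕ → ℕ), Primrec G ∧ (∀ i x y, Primrec (F i x y)) ∧
      ∀ v, v ∈ R ↔ ∃ m, G m = 0 ∧ ∀ i x y, x ≠ y → F i x y m = code x y (v i) := by
  obtain ⟨e, he, hR⟩ := exists_primrec_enum_of_rePred h
  -- The default `1` makes `G m = 0` say that `m` enumerates a tuple; the default of `F` never
  -- matters then.
  refine ⟨fun m => ((e m).map fun _ => 0).getD 1,
    fun i x y m => ((e m).map fun w => code x y (w i)).getD 0, ?_, fun i x y => ?_, fun v => ?_⟩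
  · exact Primrec.option_getD.comp (Primrec.option_map he (Primrec.const 0).to₂) (Primrec.const _)
  · refine Primrec.option_getD.comp (Primrec.option_map he ?_) (Primrec.const _)
    exact (primrec_code x y).comp (Primrec.fin_app.comp Primrec.snd (Primrec.const i))
  · rw [hR]
    refine exists_congr fun m => ?_
    beta_reduce
    rcases e m with _ | w
    · simp
    · simp only [Option.some.injEq, Option.map_some, Option.getD_some, true_and]
      exact ⟨fun h i x y _ => by rw [h], fun h => funext fun i => eq_of_code_eq (h i)⟩

theorem Definable.of_rePred [Fintype A] (hA : 3 ≤ Fintype.card A) {k : ℕ}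
    {R : Set (Fin k → List A)} (h : REPred fun v : Fin k → List A => v ∈ R) :
    Definable fun v => v ∈ R := by
  have : Nontrivial A := Fintype.one_lt_card_iff_nontrivial.1 (by omega)
  obtain ⟨a, b, hab⟩ := exists_pair_ne A
  obtain ⟨c, hd⟩ := exists_distinct hA hab
  obtain ⟨G, F, hG, hF, hR⟩ := exists_primrec_code h
  have hcount : ∀ {α : Type} (x : A) (i j : α),
      Definable fun v : α → List A => (v i).count a = (v j).count x := by
    intro α x i j
    by_cases hax : a = x
    · subst hax
      exact countEq _ _ _
    · obtain ⟨z, hz⟩ := exists_distinct hA hax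
      exact countEqCount hz _ _
  have hcode : ∀ {α : Type} (i : Fin k) (x y : A) (p q : α), Definable fun v : α → List A =>
      x = y ∨ ∃ N, (v p).count a = N.count x ∧
        ∃ K, (∃ m, N = num x y m ∧ K = num x y (F i x y m)) ∧ K = num x y (code x y (v q)) := by
    intro α i x y p q
    by_cases hxy : x = y
    · exact (const True).congr fun v => by simp [hxy]
    · obtain ⟨z, hz⟩ := exists_distinct hA hxy
      exact (const _).or <| ex <| (hcount _ _ _).and <| ex <|
        (numPrimrec hz (hF i x y) _ _).and (numCode hz _ _)
  -- The index `m` is guessed once, as `M` over the letters `a`, `b`. For each pair `x`, `y` it is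
  -- transferred to a word `N` over these letters by comparing counts, since `code x y` is written
  -- with them.
  refine (ex (P := fun v M => (∃ Z, Z = num a b 0 ∧ ∃ m, M = num a b m ∧ Z = num a b (G m)) ∧
    ∀ i x y, x = y ∨ ∃ N, M.count a = N.count x ∧
      ∃ K, (∃ m, N = num x y m ∧ K = num x y (F i x y m)) ∧ K = num x y (code x y (v i))) <|
    (ex <| (eq_const _ _).and (numPrimrec hd hG _ _)).and <|
      all fun i => all fun x => all fun y => hcode i x y _ _).congr fun v => ?_
  rw [hR]
  constructor
  · rintro ⟨m, hm, hc⟩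
    refine ⟨num a b m, ⟨_, rfl, m, rfl, by rw [hm]⟩, fun i x y => or_iff_not_imp_left.2 fun hxy => ?_⟩
    refine ⟨num x y m, by rw [count_num hab, count_num hxy], _, ⟨m, rfl, rfl⟩, ?_⟩
    rw [hc i x y hxy]
  · rintro ⟨_, ⟨_, rfl, m, rfl, hm⟩, hc⟩
    refine ⟨m, (num_inj hab hm).symm, fun i x y hxy => ?_⟩
    obtain ⟨_, hN, _, ⟨n, rfl, rfl⟩, hK⟩ := (hc i x y).resolve_left hxy
    rw [count_num hab, count_num hxy] at hN
    rw [hN]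
    exact num_inj hxy hK

end Enumerable

end Subword

theorem theorem2p1 {A : Type*} [Fintype A] [Primcodable A] (hA : 3 ≤ Fintype.card A)
    {k : ℕ} (R : Set (Fin k → List A)) :
    SigmaOneDefinable R ↔ REPred (fun v : Fin k → List A => v ∈ R) := by
  classical
  exact ⟨Subword.rePred_of_sigmaOneDefinable, fun h =>
    (Subword.Definable.of_rePred hA h).sigmaOneDefinable⟩
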